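/- Let $d\ge 1$ and $n\ge d+3$, let $V=\{v_1,\dots,v_n\}$, and call $v_1,\dots,v_d$ the poles. For a cycle $C$ with vertex set $\{v_{d+1},\dots,v_n\}$ put $f_{xy}=\{v_1,\dots,v_d,x,y\}$ for $xy\in E(C)$, let $B(C)$ be the simplicial complex consisting of all nonempty subsets of the sets $f_{xy}$, $xy\in E(C)$, and let $S_C=\partial B(C)$ be its boundary, i.e. the complex generated by the codimension-one faces of $B(C)$ that lie in exactly one facet. A simplicial $d$-sphere (simplicial $D$-ball) is a finite simplicial complex whose geometric realization is homeomorphic to the unit sphere $\mathbb S^d$ (to the closed unit ball of $\mathbb R^D$). A simplicial $D$-ball is locally constructible (LC) if it can be built from a single $D$-simplex by a sequence of the following two moves: (1) glue a new $D$-simplex, along one of its $(D-1)$-faces, to a $(D-1)$-simplex on the boundary; (2) glue together two $(D-1)$-simplices on the boundary that already overlap in a $(D-2)$-simplex, by the map that fixes this $(D-2)$-simplex; here the intermediate objects are regular cell complexes all of whose cells are simplices. A simplicial $d$-sphere is locally constructible if it is the boundary of a locally constructible $(d+1)$-ball. Then, for every such cycle $C$: (a) $B(C)=\mathrm{Cone}_{v_1}(\mathrm{Cone}_{v_2}(\cdots\mathrm{Cone}_{v_d}(C)\cdots))$,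 where $\mathrm{Cone}_z(K)$ adds to $K$ the vertex $z$ and the simplex $s\cup\{z\}$ for every $s\in K$; thus $S_C=\partial(\mathrm{Cone}^d C)$; (b) $S_C$ is a locally constructible simplicial $d$-sphere; (c) the facets of $S_C$ are exactly the sets $f_{xy}\setminus\{v_i\}$ with $xy\in E(C)$ and $1\le i\le d$, and there are $d(n-d)$ of them. In particular, let $S^*_{n,d}$ be the complex whose facets are the $(d+1)$-subsets of $V$ whose intersection with $\{v_1,\dots,v_{n-d}\}$ is one of $\{v_1,v_2\},\dots,\{v_{n-d-1},v_{n-d}\},\{v_{n-d},v_1\}$. For the cycle $C=v_{d+1}v_{d+2}\cdots v_nv_{d+1}$, the cyclic relabelling $v_{d+j}\mapsto v_j$ ($1\le j\le n-d$), $v_i\mapsto v_{n-d+i}$ ($1\le i\le d$) carries $S_C$ onto $S^*_{n,d}$, and $S^*_{n,d}$ is a locally constructible simplicial $d$-sphere. -/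

import Mathlib

namespace LCSphere

/-! ### Simplicial complexes -/

section Complexes

variable {V : Type} [DecidableEq V]

/-- The simplicial complex generated by a family of finite sets: all their nonempty subsets. -/
def closure (F : Set (Finset V)) : PreAbstractSimplicialComplex V where
  faces := {s | s.Nonempty ∧ ∃ t ∈ F, s ⊆ t}
  isRelLowerSet_faces := by
    rintro s ⟨hs, t, ht, hst⟩
    exact ⟨hs, fun u hu hne => ⟨hne, t, ht, hu.trans hst⟩⟩

/-- The facets of a complex are its inclusion-maximal faces. -/
def facets (K : PreAbstractSimplicialComplex V) : Set (Finset V) :=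
  {s | Maximal (· ∈ K.faces) s}

/-- The boundary of a (pure) complex: the complex generated by those codimension-one faces that
lie in exactly one facet. -/
def boundary (K : PreAbstractSimplicialComplex V) : PreAbstractSimplicialComplex V :=
  closure {s | ∃ t ∈ facets K, s ⊆ t ∧ s.card + 1 = t.card ∧ ∀ t' ∈ facets K, s ⊆ t' → t' = t}

/-- The cone with apex `z`: add the vertex `z` and the simplex `s ∪ {z}` for every `s ∈ K`. -/
def cone (z : V) (K : PreAbstractSimplicialComplex V) : PreAbstractSimplicialComplex V where
  faces := K.faces ∪ {s | ∃ t, (t = ∅ ∨ t ∈ K.faces) ∧ s = insert z t}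
  isRelLowerSet_faces := by
    have key : ∀ t : Finset V, (t = ∅ ∨ t ∈ K.faces) → ∀ u ⊆ t, u = ∅ ∨ u ∈ K.faces := by
      intro t ht u hu
      rcases u.eq_empty_or_nonempty with h | h
      · exact Or.inl h
      · rcases ht with rfl | ht
        · exact Or.inl (Finset.subset_empty.mp hu)
        · exact Or.inr ((K.isRelLowerSet_faces ht).2 hu h)
    rintro s (hs | ⟨t, ht, rfl⟩)
    · exact ⟨(K.isRelLowerSet_faces hs).1,
        fun u hu hne => Or.inl ((K.isRelLowerSet_faces hs).2 hu hne)⟩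
    · refine ⟨Finset.insert_nonempty _ _, fun u hu hne => ?_⟩
      have hu' : u.erase z ⊆ t := Finset.subset_insert_iff.mp hu
      by_cases hz : z ∈ u
      · exact Or.inr ⟨u.erase z, key t ht _ hu', (Finset.insert_erase hz).symm⟩
      · rw [Finset.erase_eq_of_notMem hz] at hu'
        rcases key t ht u hu' with h | h
        · exact absurd h hne.ne_empty
        · exact Or.inl h

/-- The geometric realization of a complex on a finite vertex set, in barycentric coordinates. -/
def realization [Fintype V] (K : PreAbstractSimplicialComplex V) : Set (V → ℝ) :=
  {x | x ∈ stdSimplex ℝ V ∧ Finset.univ.filter (fun v => x v ≠ 0) ∈ K.faces}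

/-- A simplicial `d`-sphere is a complex homeomorphic to the unit sphere of `ℝ^(d+1)`. -/
def IsSimplicialSphere [Fintype V] (d : ℕ) (K : PreAbstractSimplicialComplex V) : Prop :=
  Nonempty (realization K ≃ₜ Metric.sphere (0 : EuclideanSpace ℝ (Fin (d + 1))) 1)

/-- A simplicial `D`-ball is a complex homeomorphic to the closed unit ball of `ℝ^D`. -/
def IsSimplicialBall [Fintype V] (D : ℕ) (K : PreAbstractSimplicialComplex V) : Prop :=
  Nonempty (realization K ≃ₜ Metric.closedBall (0 : EuclideanSpace ℝ (Fin D)) 1)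

end Complexes

/-! ### Local constructions

The intermediate stages of a local construction are regular cell complexes all of whose cells are
simplices; two cells may share all their vertices, so that such a complex need not be a simplicial
complex. It is given by its poset of (nonempty) cells, in which the cells below a given one form
the face poset of a simplex. -/

section LocalConstructions

/-- The poset of nonempty faces of a `D`-simplex. -/
abbrev SimplexPoset (D : ℕ) : Type := {s : Finset (Fin (D + 1)) // s.Nonempty}

/-- A codimension-one cell on the boundary: a facet of exactly one maximal cell. -/
def IsBoundaryRidge {P : Type} [PartialOrder P] (σ : P) : Prop :=
  ∃ m : P, IsMax m ∧ σ ⋖ m ∧ ∀ m' : P, IsMax m' → σ ≤ m' → m' = m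

/-- `Q` arises from `P` by gluing a new `D`-simplex `m`, along one of its `(D-1)`-faces, to a
`(D-1)`-simplex `σ` on the boundary of `P`. -/
def GluesNewSimplex (D : ℕ) (P Q : Type) [PartialOrder P] [PartialOrder Q] : Prop :=
  ∃ (ι : P ↪o Q) (σ : P) (m : Q),
    IsBoundaryRidge σ ∧
    Nonempty (Set.Iic m ≃o SimplexPoset D) ∧
    IsLowerSet (Set.range ι) ∧
    Set.range ι ∪ Set.Iic m = Set.univ ∧
    Set.range ι ∩ Set.Iic m = Set.Iic (ι σ)

/-- `Q` arises from `P` by gluing together two codimension-one simplices `σ`, `τ` on the boundary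
of `P` that already overlap in a codimension-two simplex `ρ`. The gluing map `φ` fixes `ρ`, the
map `q` is the quotient map, and it keeps every cell of `P` a simplex (no two faces of one and
the same cell are identified). -/
def GluesBoundaryPair (P Q : Type) [PartialOrder P] [PartialOrder Q] : Prop :=
  ∃ (σ τ ρ : P) (φ : Set.Iic σ ≃o Set.Iic τ) (q : P → Q),
    σ ≠ τ ∧ IsBoundaryRidge σ ∧ IsBoundaryRidge τ ∧
    ρ ⋖ σ ∧ ρ ⋖ τ ∧
    (∀ x : Set.Iic σ, (x : P) ≤ ρ → (φ x : P) = x) ∧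
    Function.Surjective q ∧
    (∀ x y : P, q x = q y ↔
      x = y ∨ (∃ z : Set.Iic σ, (z : P) = x ∧ (φ z : P) = y) ∨
        (∃ z : Set.Iic σ, (z : P) = y ∧ (φ z : P) = x)) ∧
    (∀ x : P, ∃ e : Set.Iic x ≃o Set.Iic (q x), ∀ y : Set.Iic x, (e y : Q) = q y)

/-- The `D`-dimensional cell complexes that can be built from a single `D`-simplex by the two
gluing moves. -/
inductive LocallyConstructed (D : ℕ) : (P : Type) → [PartialOrder P] → Prop
  | simplex (P : Type) [PartialOrder P] (e : P ≃o SimplexPoset D) : LocallyConstructed D P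
  | glueNew (P Q : Type) [PartialOrder P] [PartialOrder Q] (hP : LocallyConstructed D P)
      (h : GluesNewSimplex D P Q) : LocallyConstructed D Q
  | gluePair (P Q : Type) [PartialOrder P] [PartialOrder Q] (hP : LocallyConstructed D P)
      (h : GluesBoundaryPair P Q) : LocallyConstructed D Q

variable {V : Type} [DecidableEq V] [Fintype V]

/-- A locally constructible `D`-ball: a simplicial `D`-ball whose face poset can be built by the
two gluing moves. -/
def IsLCBall (D : ℕ) (K : PreAbstractSimplicialComplex V) : Prop :=
  IsSimplicialBall D K ∧ LocallyConstructed D K.faces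

/-- A locally constructible `d`-sphere: a simplicial `d`-sphere that is (up to naming the vertices,
with additional interior vertices allowed) the boundary of a locally constructible
`(d+1)`-ball. -/
def IsLCSphere (d : ℕ) (S : PreAbstractSimplicialComplex V) : Prop :=
  IsSimplicialSphere d S ∧
    ∃ (m : ℕ) (f : V ↪ Fin m) (B : PreAbstractSimplicialComplex (Fin m)),
      IsLCBall (d + 1) B ∧ boundary B = S.map f

end LocalConstructions

/-! ### The spheres `S_C` and `S*_{n,d}`

The vertex `v_i` is the element `i - 1` of `Fin n`. -/

section Spheres

/-- The poles `v_1, …, v_d`. -/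
def poles (n d : ℕ) : Finset (Fin n) := Finset.univ.filter (fun i : Fin n => (i : ℕ) < d)

/-- The non-pole vertices `v_{d+1}, …, v_n`. -/
abbrev NonPole (n d : ℕ) : Type := {i : Fin n // d ≤ (i : ℕ)}

/-- `C` is a Hamilton cycle on the non-pole vertices. -/
def IsHamiltonCycle {n d : ℕ} (C : SimpleGraph (NonPole n d)) : Prop :=
  3 ≤ n - d ∧ Nonempty (C ≃g SimpleGraph.cycleGraph (n - d))

/-- The set `f_{xy} = {v_1, …, v_d, x, y}`. -/
def fSet {n d : ℕ} (x y : NonPole n d) : Finset (Fin n) := poles n d ∪ {x.1, y.1}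

/-- `B(C)`, the closure of the family of all `f_{xy}` with `xy ∈ E(C)`. -/
def ballOf {n d : ℕ} (C : SimpleGraph (NonPole n d)) : PreAbstractSimplicialComplex (Fin n) :=
  closure {s | ∃ x y : NonPole n d, C.Adj x y ∧ s = fSet x y}

/-- `S_C`, the boundary of `B(C)`. -/
def sphereOf {n d : ℕ} (C : SimpleGraph (NonPole n d)) : PreAbstractSimplicialComplex (Fin n) :=
  boundary (ballOf C)

/-- The graph `C` without isolated vertices as a one-dimensional complex. -/
def graphComplex {n d : ℕ} (C : SimpleGraph (NonPole n d)) :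
    PreAbstractSimplicialComplex (Fin n) :=
  closure {s | ∃ x y : NonPole n d, C.Adj x y ∧ s = {x.1, y.1}}

/-- The iterated cone `Cone_{v_1}(Cone_{v_2}(⋯ Cone_{v_d}(C) ⋯))`. -/
def iteratedCone {n d : ℕ} (C : SimpleGraph (NonPole n d)) :
    PreAbstractSimplicialComplex (Fin n) :=
  ((List.finRange n).filter (fun i : Fin n => (i : ℕ) < d)).foldr cone (graphComplex C)

/-- The cycle `v_{d+1} v_{d+2} ⋯ v_n v_{d+1}`. -/
def standardCycle (n d : ℕ) : SimpleGraph (NonPole n d) :=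
  SimpleGraph.fromRel fun x y => (y.1 : ℕ) - d = ((x.1 : ℕ) - d + 1) % (n - d)

/-- `S*_{n,d}`: its facets are the `(d+1)`-sets whose intersection with `{v_1, …, v_{n-d}}` is one
of `{v_1, v_2}, …, {v_{n-d-1}, v_{n-d}}, {v_{n-d}, v_1}`. -/
def starSphere (n d : ℕ) : PreAbstractSimplicialComplex (Fin n) :=
  closure {s | s.card = d + 1 ∧ ∃ i j : Fin n, (i : ℕ) < n - d ∧
    (j : ℕ) = ((i : ℕ) + 1) % (n - d) ∧
    s.filter (fun k : Fin n => (k : ℕ) < n - d) = {i, j}}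

end Spheres

end LCSphere

/-! Put `n = d + (k + 3)`. The complex `B(C)` is the join of the full simplex on the `d` poles with
a cycle of length `k + 3`, and everything is proved for this join (`joinBall`) and then transported
along a labelling of the vertices.

Boundary: a ridge that omits a cycle vertex lies in two neighbouring facets, while a ridge that
omits a pole contains a whole edge of the cycle and so lies in only one. Hence the boundary is the
join of the boundary of the pole simplex with the cycle (`boundary_joinBall`), which also gives the
list and number of facets.

Topology: send one pole to the origin, the other poles to the standard basis vectors, and the cycle
to the vertices of a convex polygon in a complementary plane. The linear extension is injective on
the realization, its image is a convex body, and the boundary sphere goes exactly onto the frontier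
(`injOn_joinMap`, `image_joinMap`, `image_joinMap_joinSphere`). A convex body with nonempty interior
is a ball whose frontier is a sphere.

Local construction: cut the cycle open into a path. The join of the pole simplex with the path is a
stack of `(d+1)`-simplices, each glued to the previous one along a ridge. The two end ridges share
the pole simplex, which is nonempty because `1 ≤ d` and has codimension one in both, so a single
move of the second kind closes the cycle (`gluesBoundaryPair_pathBall_joinBall`). -/

namespace LCSphere

open Finset

/-! ### Generated complexes and iterated cones -/

section Combinatorics

variable {V W : Type}

theorem map_closure [DecidableEq W] (F : Set (Finset V)) (f : V → W) :
    (closure F).map f = closure ((fun s => s.image f) '' F) := by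
  ext u
  constructor
  · rintro ⟨s, ⟨hs, t, ht, hst⟩, rfl⟩
    exact ⟨hs.image f, _, ⟨t, ht, rfl⟩, image_subset_image hst⟩
  · rintro ⟨hu, _, ⟨t, ht, rfl⟩, hut⟩
    obtain ⟨s, hs, rfl⟩ := subset_image_iff.mp hut
    exact ⟨s, ⟨image_nonempty.mp hu, t, ht, hs⟩, rfl⟩

/-- If all generators of a complex have the same positive cardinality, they are its facets. -/
theorem facets_closure {F : Set (Finset V)} {D : ℕ} (h : ∀ s ∈ F, s.card = D + 1) :
    facets (closure F) = F := by
  ext s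
  constructor
  · rintro ⟨⟨hs, t, ht, hst⟩, hmax⟩
    have htF : t ∈ (closure F).faces :=
      ⟨card_pos.mp (by rw [h t ht]; omega), t, ht, Subset.rfl⟩
    exact (hst.antisymm (hmax htF hst)) ▸ ht
  · intro hs
    refine ⟨⟨card_pos.mp (by rw [h s hs]; omega), s, hs, Subset.rfl⟩, ?_⟩
    rintro t ⟨-, u, hu, htu⟩ hst
    have : s = u := eq_of_subset_of_card_le (hst.trans htu) (by rw [h s hs, h u hu])
    exact this ▸ htu

variable [DecidableEq V]

/-- Nonemptiness of `F` is needed for the apex: a cone always contains `{z}`, whereas the empty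
family generates no faces. -/
theorem cone_closure {F : Set (Finset V)} (hF : F.Nonempty) (z : V) :
    cone z (closure F) = closure ((fun s => insert z s) '' F) := by
  ext u
  constructor
  · rintro (⟨hu, t, ht, hut⟩ | ⟨t, rfl | ⟨-, s, hs, hts⟩, rfl⟩)
    · exact ⟨hu, _, ⟨t, ht, rfl⟩, hut.trans (subset_insert _ _)⟩
    · obtain ⟨s, hs⟩ := hF
      exact ⟨insert_nonempty _ _, _, ⟨s, hs, rfl⟩, insert_subset_insert _ (empty_subset _)⟩
    · exact ⟨insert_nonempty _ _, _, ⟨s, hs, rfl⟩, insert_subset_insert _ hts⟩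
  · rintro ⟨hu, _, ⟨t, ht, rfl⟩, hut⟩
    by_cases hz : z ∈ u
    · refine Or.inr ⟨u.erase z, ?_, (insert_erase hz).symm⟩
      rcases (u.erase z).eq_empty_or_nonempty with h | h
      · exact Or.inl h
      · exact Or.inr ⟨h, t, ht, subset_insert_iff.mp hut⟩
    · exact Or.inl ⟨hu, t, ht, (subset_insert_iff_of_notMem hz).mp hut⟩

theorem foldr_cone_closure {F : Set (Finset V)} (hF : F.Nonempty) (L : List V) :
    L.foldr cone (closure F) = closure ((fun s => L.toFinset ∪ s) '' F) := by
  induction L with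
  | nil => simp
  | cons z L ih =>
    rw [List.foldr_cons, ih, cone_closure (hF.image _), Set.image_image]
    simp [insert_union]

end Combinatorics

/-! ### The join of a simplex and a cycle, and its boundary -/

section Join

variable {V W : Type} [DecidableEq V] [DecidableEq W] {d k : ℕ} (E : Fin d ⊕ Fin (k + 3) ≃ V)

/-- The facets of the join of the simplex on `d` vertices and the cycle of length `k + 3`. -/
def joinFacet (j : Fin (k + 3)) : Finset V :=
  univ.image (fun i => E (.inl i)) ∪ {E (.inr j), E (.inr (j + 1))}

/-- The join of the simplex on `d` vertices and the cycle of length `k + 3`. -/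
def joinBall : PreAbstractSimplicialComplex V := closure (Set.range (joinFacet E))

/-- The facets of the join of the boundary of a simplex and a cycle. -/
def joinSphereFacet (p : Fin d × Fin (k + 3)) : Finset V := (joinFacet E p.2).erase (E (.inl p.1))

/-- The join of the boundary of the simplex on `d` vertices and the cycle of length `k + 3`. -/
def joinSphere : PreAbstractSimplicialComplex V := closure (Set.range (joinSphereFacet E))

@[simp]
theorem inl_mem_joinFacet (i : Fin d) (j : Fin (k + 3)) : E (.inl i) ∈ joinFacet E j := by
  simp [joinFacet]

@[simp]
theorem inr_mem_joinFacet (l j : Fin (k + 3)) :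
    E (.inr l) ∈ joinFacet E j ↔ l = j ∨ l = j + 1 := by
  simp [joinFacet]

theorem fin_add_one_ne (j : Fin (k + 3)) : j + 1 ≠ j := by
  simp

theorem fin_add_one_add_one_ne (j : Fin (k + 3)) : j + 1 + 1 ≠ j := by
  rw [add_assoc, Ne, add_eq_left]
  intro h
  have := congrArg Fin.val h
  rw [Fin.val_add, Fin.val_one, Nat.mod_eq_of_lt (by omega)] at this
  simp at this

/-- An edge of a cycle determines its index. This is where length at least three matters: in a
2-cycle the edges `{0, 1}` and `{1, 0}` would coincide. -/
theorem eq_of_pair_subset {j l : Fin (k + 3)} (h₁ : j = l ∨ j = l + 1)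
    (h₂ : j + 1 = l ∨ j + 1 = l + 1) : j = l := by
  rcases h₁ with rfl | rfl
  · rfl
  · rcases h₂ with h | h
    · exact absurd h (fin_add_one_add_one_ne l)
    · exact absurd h (fin_add_one_ne _)

theorem card_joinFacet (j : Fin (k + 3)) : (joinFacet E j).card = d + 1 + 1 := by
  rw [joinFacet, card_union_of_disjoint]
  · rw [card_image_of_injective _ (fun a b h => by simpa using h), card_pair]
    · simp
    · simp
  · simp [disjoint_left]

theorem card_joinSphereFacet (p : Fin d × Fin (k + 3)) :
    (joinSphereFacet E p).card = d + 1 := by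
  rw [joinSphereFacet, card_erase_of_mem (by simp), card_joinFacet]
  rfl

theorem joinSphereFacet_subset_iff (p : Fin d × Fin (k + 3)) (l : Fin (k + 3)) :
    joinSphereFacet E p ⊆ joinFacet E l ↔ p.2 = l := by
  constructor
  · intro h
    have h₁ : E (.inr p.2) ∈ joinFacet E l := h (by simp [joinSphereFacet])
    have h₂ : E (.inr (p.2 + 1)) ∈ joinFacet E l := h (by simp [joinSphereFacet])
    rw [inr_mem_joinFacet] at h₁ h₂
    exact eq_of_pair_subset h₁ h₂
  · rintro rfl
    exact erase_subset _ _

theorem joinSphereFacet_injective : Function.Injective (joinSphereFacet E) := by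
  intro p q h
  have h₂ : p.2 = q.2 := (joinSphereFacet_subset_iff E p q.2).mp (h ▸ erase_subset _ _)
  refine Prod.ext ?_ h₂
  by_contra hne
  have : E (.inl p.1) ∈ joinSphereFacet E q := by simp [joinSphereFacet, hne]
  rw [← h] at this
  simp [joinSphereFacet] at this

theorem facets_joinBall : facets (joinBall E) = Set.range (joinFacet E) :=
  facets_closure (D := d + 1) (by rintro _ ⟨j, rfl⟩; exact card_joinFacet E j)

theorem facets_joinSphere : facets (joinSphere E) = Set.range (joinSphereFacet E) :=
  facets_closure (D := d) (by rintro _ ⟨j, rfl⟩; exact card_joinSphereFacet E j)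

theorem ncard_facets_joinSphere : (facets (joinSphere E)).ncard = d * (k + 3) := by
  rw [facets_joinSphere, Set.ncard_range_of_injective (joinSphereFacet_injective E)]
  simp

/-- A ridge arises from a facet by omitting one vertex. If that vertex belongs to the simplex, the
ridge still contains the edge `{j, j + 1}` and thereby determines its facet; if it belongs to the
cycle, the ridge also lies in an adjacent facet. -/
theorem boundary_joinBall : boundary (joinBall E) = joinSphere E := by
  unfold boundary joinSphere
  congr 1
  ext s
  simp only [facets_joinBall, Set.mem_ofPred_eq, Set.exists_range_iff, Set.forall_mem_range]
  constructor
  · rintro ⟨j, hs, hcard, huniq⟩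
    obtain ⟨v, hv⟩ : ∃ v, joinFacet E j \ s = {v} := by
      rw [← card_eq_one, card_sdiff_of_subset hs]
      omega
    have hsv : s = (joinFacet E j).erase v := by
      rw [← Finset.sdiff_sdiff_eq_self hs, hv, sdiff_singleton_eq_erase]
    have key : ∀ l, s ⊆ joinFacet E l → j = l := fun l hl => by
      have h := huniq l hl
      have h₁ : E (.inr j) ∈ joinFacet E l := h ▸ (by simp)
      have h₂ : E (.inr (j + 1)) ∈ joinFacet E l := h ▸ (by simp)
      rw [inr_mem_joinFacet] at h₁ h₂
      exact eq_of_pair_subset h₁ h₂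
    obtain ⟨i | l, rfl⟩ := E.surjective v
    · exact ⟨(i, j), hsv.symm⟩
    · exfalso
      have hl : E (.inr l) ∈ joinFacet E j :=
        sdiff_subset (hv ▸ mem_singleton_self _)
      rw [inr_mem_joinFacet] at hl
      have hsub : ∀ l', (∀ a, a = j ∨ a = j + 1 → a ≠ l → a = l' ∨ a = l' + 1) →
          s ⊆ joinFacet E l' := by
        intro l' h' w hw
        rw [hsv, mem_erase] at hw
        obtain ⟨i | a, rfl⟩ := E.surjective w
        · simp
        · rw [inr_mem_joinFacet] at hw ⊢
          exact h' a hw.2 (fun h => hw.1 (by rw [h]))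
      -- Omitting the first endpoint of the edge leaves a subset of the next facet; omitting the
      -- second leaves a subset of the previous one.
      rcases hl with rfl | rfl
      · have := key (l + 1) (hsub _ fun a ha hne => by
          rcases ha with rfl | rfl
          · exact absurd rfl hne
          · exact Or.inl rfl)
        exact fin_add_one_ne _ this.symm
      · have := key (j - 1) (hsub _ fun a ha hne => by
          rcases ha with rfl | rfl
          · simp
          · exact absurd rfl hne)
        exact fin_add_one_ne (j - 1) (by rw [← this]; simpa using this.symm)
  · rintro ⟨p, rfl⟩
    refine ⟨p.2, erase_subset _ _, ?_, fun l hl => ?_⟩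
    · rw [card_joinSphereFacet, card_joinFacet]
    · rw [(joinSphereFacet_subset_iff E p l).mp hl]

theorem image_joinFacet (e : V ≃ W) (j : Fin (k + 3)) :
    (joinFacet E j).image e = joinFacet (E.trans e) j := by
  simp [joinFacet, image_image, Function.comp_def, image_insert]

theorem map_joinSphere (e : V ≃ W) : (joinSphere E).map e = joinSphere (E.trans e) := by
  rw [joinSphere, map_closure, joinSphere, ← Set.range_comp]
  congr 2
  funext p
  simp [joinSphereFacet, image_erase e.injective, image_joinFacet]

end Join

/-! ### Frontiers of polyhedra, and convex bodies as balls -/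

section ConvexBodies

/-- The frontier of a polyhedron given by finitely many nonconstant inequalities. -/
theorem frontier_iInter_preimage_Iic {F κ : Type*} [NormedAddCommGroup F] [NormedSpace ℝ F]
    [Finite κ] (f : κ → F →L[ℝ] ℝ) (hf : ∀ i, f i ≠ 0) (c : κ → ℝ) :
    frontier (⋂ i, f i ⁻¹' Set.Iic (c i)) =
      {y | (∀ i, f i y ≤ c i) ∧ ∃ i, f i y = c i} := by
  have hclosed : IsClosed (⋂ i, f i ⁻¹' Set.Iic (c i)) :=
    isClosed_iInter fun i => isClosed_Iic.preimage (f i).continuous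
  -- A nonzero functional is an open map, so taking interiors commutes with its preimages.
  have hint : ∀ i, interior (f i ⁻¹' Set.Iic (c i)) = f i ⁻¹' Set.Iio (c i) := fun i => by
    rw [← IsOpenMap.preimage_interior_eq_interior_preimage ((f i).isOpenMap_of_ne_zero (hf i))
      (f i).continuous, interior_Iic]
  rw [hclosed.frontier_eq, interior_iInter_of_finite]
  ext y
  simp only [hint, Set.mem_sdiff, Set.mem_iInter, Set.mem_preimage, Set.mem_Iic, Set.mem_Iio,
    Set.mem_ofPred_eq, not_forall, not_lt]
  exact and_congr_right fun h => exists_congr fun i =>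
    ⟨fun h' => (h i).antisymm h', fun h' => h'.ge⟩

theorem nonempty_homeomorph_image {X Y : Type*} [TopologicalSpace X] [TopologicalSpace Y]
    [T2Space Y] {K : Set X} (hK : IsCompact K) {f : X → Y} (hf : Continuous f)
    (hinj : Set.InjOn f K) {s : Set Y} (hs : f '' K = s) : Nonempty (K ≃ₜ s) := by
  subst hs
  have : CompactSpace K := isCompact_iff_compactSpace.mp hK
  have hc : Continuous (Equiv.Set.imageOfInjOn f K hinj) :=
    Continuous.subtype_mk (hf.comp continuous_subtype_val) _
  exact ⟨hc.homeoOfEquivCompactToT2⟩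

/-- A compact set which is mapped bijectively onto a convex body is a ball, and the preimage of
the frontier of the body is a sphere. -/
theorem nonempty_homeomorph_of_image_convex {X F : Type*} [TopologicalSpace X]
    [NormedAddCommGroup F] [NormedSpace ℝ F] [FiniteDimensional ℝ F] {N : ℕ}
    (hN : Module.finrank ℝ F = N) {f : X → F} (hf : Continuous f) {K L : Set X}
    (hK : IsCompact K) (hL : L ⊆ K) (hinj : Set.InjOn f K) (hconv : Convex ℝ (f '' K))
    (hne : (interior (f '' K)).Nonempty) (hLf : f '' L = frontier (f '' K)) :
    Nonempty (K ≃ₜ Metric.closedBall (0 : EuclideanSpace ℝ (Fin N)) 1) ∧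
      Nonempty (L ≃ₜ Metric.sphere (0 : EuclideanSpace ℝ (Fin N)) 1) := by
  let A : F ≃L[ℝ] EuclideanSpace ℝ (Fin N) := ContinuousLinearEquiv.ofFinrankEq (by simp [hN])
  have hcomp : IsCompact (f '' K) := hK.image hf
  have hcompA : IsCompact (A '' (f '' K)) := hcomp.image A.continuous
  obtain ⟨h, -, hcl, hfr⟩ := exists_homeomorph_image_interior_closure_frontier_eq_unitBall
    (s := A '' (f '' K)) (hconv.linear_image A.toLinearEquiv.toLinearMap)
    (by
      rw [show (A : F → _) = A.toHomeomorph from rfl, ← Homeomorph.image_interior]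
      exact hne.image _)
    hcompA.isBounded
  rw [hcompA.isClosed.closure_eq] at hcl
  have hfrA : frontier (A '' (f '' K)) = A '' (f '' L) := by
    rw [hLf, show (A : F → _) = A.toHomeomorph from rfl, ← Homeomorph.image_frontier]
  rw [hfrA] at hfr
  have hg : Continuous (h ∘ A ∘ f) := h.continuous.comp (A.continuous.comp hf)
  have hginj : Set.InjOn (h ∘ A ∘ f) K :=
    (h.injective.comp A.injective).comp_injOn hinj
  rw [← Set.image_comp, ← Set.image_comp] at hcl hfr
  -- `L` is not assumed closed; as the part of `K` lying over the sphere, it is compact.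
  have hLK : L = K ∩ (h ∘ A ∘ f) ⁻¹' Metric.sphere 0 1 := by
    ext x
    constructor
    · exact fun hx => ⟨hL hx, hfr ▸ Set.mem_image_of_mem _ hx⟩
    · rintro ⟨hx, hx'⟩
      rw [Set.mem_preimage, ← hfr] at hx'
      obtain ⟨y, hy, hyx⟩ := hx'
      exact hginj (hL hy) hx hyx ▸ hy
  have hLc : IsCompact L := hLK ▸ hK.inter_right (Metric.isClosed_sphere.preimage hg)
  exact ⟨nonempty_homeomorph_image hK hg hginj hcl,
    nonempty_homeomorph_image hLc hg (hginj.mono hL) hfr⟩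

end ConvexBodies

/-! ### The regular polygon and the fan over its edges -/

section Polygon

theorem cos_lt_cos_of_lt_two_pi_sub {a t : ℝ} (ha : 0 ≤ a) (h₁ : a < t)
    (h₂ : t < 2 * Real.pi - a) : Real.cos t < Real.cos a := by
  rcases le_total t Real.pi with ht | ht
  · exact Real.cos_lt_cos_of_nonneg_of_le_pi ha ht h₁
  · rw [← Real.cos_two_pi_sub t]
    exact Real.cos_lt_cos_of_nonneg_of_le_pi ha (by linarith) (by linarith)

theorem fin_add_one_cast (k : ℕ) (j : Fin (k + 3)) :
    ∃ q : ℤ, (((j + 1 : Fin (k + 3)) : ℕ) : ℝ) = (j : ℕ) + 1 - q * (k + 3) := by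
  rw [Fin.val_add_one]
  split_ifs with h
  · subst h
    exact ⟨1, by simp; ring⟩
  · exact ⟨0, by simp⟩

/-- The vertices of a polygon with `k + 3` sides, together with the linear functionals
whose level sets at height `1` are the supporting lines of the edges. -/
structure Polygon (k : ℕ) where
  /-- The vertices, in cyclic order. -/
  vertex : Fin (k + 3) → ℝ × ℝ
  /-- The functional that is `1` on the edge between `vertex j` and `vertex (j + 1)`. -/
  edge : Fin (k + 3) → ℝ × ℝ →L[ℝ] ℝ
  edge_left : ∀ j, edge j (vertex j) = 1
  edge_right : ∀ j, edge j (vertex (j + 1)) = 1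
  edge_lt : ∀ j l, l ≠ j → l ≠ j + 1 → edge j (vertex l) < 1
  span : ∀ j w, ∃ α β : ℝ, α • vertex j + β • vertex (j + 1) = w

/-- The regular polygon. -/
theorem nonempty_polygon (k : ℕ) : Nonempty (Polygon k) := by
  have hm : (0 : ℝ) < k + 3 := by positivity
  set a : ℝ := Real.pi / (k + 3) with ha
  have ham : a * (k + 3) = Real.pi := by rw [ha]; field_simp
  have ha0 : 0 < a := by positivity
  have ha3 : 3 * a ≤ Real.pi := by nlinarith [(Nat.cast_nonneg k : (0 : ℝ) ≤ k)]
  have hcos : 0 < Real.cos a := Real.cos_pos_of_mem_Ioo ⟨by linarith, by linarith⟩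
  -- Vertex `j` sits at angle `2aj` on the unit circle. The functional of edge `j` is the inner
  -- product with the unit vector at the midpoint angle `2aj + a`, divided by the inradius `cos a`.
  let c : ℝ → ℝ × ℝ := fun t => (Real.cos t, Real.sin t)
  let φ : ℝ → ℝ × ℝ →L[ℝ] ℝ := fun t => (Real.cos a)⁻¹ •
    (Real.cos t • ContinuousLinearMap.fst ℝ ℝ ℝ + Real.sin t • ContinuousLinearMap.snd ℝ ℝ ℝ)
  have hφ : ∀ s t, φ s (c t) = Real.cos (t - s) / Real.cos a := fun s t => by
    simp only [φ, c, smul_apply, add_apply,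
      ContinuousLinearMap.coe_fst', ContinuousLinearMap.coe_snd', smul_eq_mul, Real.cos_sub]
    ring
  have hsucc : ∀ j : Fin (k + 3),
      c (2 * a * ((j + 1 : Fin (k + 3)) : ℕ)) = c (2 * a * j + 2 * a) := by
    intro j
    obtain ⟨q, hq⟩ := fin_add_one_cast k j
    have : 2 * a * ((j + 1 : Fin (k + 3)) : ℕ) = 2 * a * j + 2 * a - q * (2 * Real.pi) := by
      rw [hq, ← ham]; ring
    simp only [c, this, Real.cos_sub_int_mul_two_pi, Real.sin_sub_int_mul_two_pi]
  refine ⟨⟨fun j => c (2 * a * j), fun j => φ (2 * a * j + a), fun j => ?_, fun j => ?_,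
    fun j l h₁ h₂ => ?_, fun j w => ?_⟩⟩
  · rw [hφ, show 2 * a * (j : ℕ) - (2 * a * (j : ℕ) + a) = -a by ring, Real.cos_neg,
      div_self hcos.ne']
  · simp only [hsucc]
    rw [hφ, show 2 * a * (j : ℕ) + 2 * a - (2 * a * (j : ℕ) + a) = a by ring,
      div_self hcos.ne']
  · rw [hφ, div_lt_one hcos, ← Real.cos_abs]
    have hj := j.isLt
    have hl := l.isLt
    have h₁' : (l : ℕ) ≠ j := fun h => h₁ (Fin.ext h)
    have h₂' : (l : ℕ) ≠ j + 1 := fun h => h₂ (Fin.ext (by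
      rw [h, Fin.val_add_one, if_neg]
      rintro rfl
      simp at h
      omega))
    have h₃ : ¬((l : ℕ) = 0 ∧ (j : ℕ) = k + 2) := fun h => h₂ (Fin.ext (by
      rw [Fin.val_add_one, if_pos (Fin.ext h.2), h.1]))
    -- The angle between vertex `l` and the midpoint of edge `j` is an odd multiple of `a`. The
    -- multiples `±1` and `-(2k + 5)` are the endpoints of the edge, the last one by wraparound.
    -- What remains lies strictly between `a` and `2π - a`, where the cosine is below `cos a`.
    have key : 3 ≤ |2 * ((l : ℕ) : ℤ) - 2 * ((j : ℕ) : ℤ) - 1| ∧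
        |2 * ((l : ℕ) : ℤ) - 2 * ((j : ℕ) : ℤ) - 1| ≤ 2 * k + 3 := by
      rcases abs_cases (2 * ((l : ℕ) : ℤ) - 2 * ((j : ℕ) : ℤ) - 1) with h | h <;> omega
    have hcast : |2 * a * (l : ℕ) - (2 * a * (j : ℕ) + a)| =
        ((|2 * ((l : ℕ) : ℤ) - 2 * ((j : ℕ) : ℤ) - 1| : ℤ) : ℝ) * a := by
      push_cast
      rw [← abs_of_pos ha0, ← abs_mul, abs_of_pos ha0]
      congr 1
      ring
    have k₁ : (3 : ℝ) ≤ ((|2 * ((l : ℕ) : ℤ) - 2 * ((j : ℕ) : ℤ) - 1| : ℤ) : ℝ) := by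
      exact_mod_cast key.1
    have k₂ : ((|2 * ((l : ℕ) : ℤ) - 2 * ((j : ℕ) : ℤ) - 1| : ℤ) : ℝ) ≤ 2 * k + 3 := by
      exact_mod_cast key.2
    rw [hcast]
    generalize ((|2 * ((l : ℕ) : ℤ) - 2 * ((j : ℕ) : ℤ) - 1| : ℤ) : ℝ) = N at k₁ k₂
    refine cos_lt_cos_of_lt_two_pi_sub ha0.le (by nlinarith) ?_
    rw [← ham]
    nlinarith
  · have hdet : Real.cos (2 * a * j) * Real.sin (2 * a * j + 2 * a) -
        Real.sin (2 * a * j) * Real.cos (2 * a * j + 2 * a) = Real.sin (2 * a) := by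
      rw [show Real.sin (2 * a) = Real.sin (2 * a * j + 2 * a - 2 * a * j) by ring_nf,
        Real.sin_sub (2 * a * j + 2 * a)]
      ring
    have hsin : Real.sin (2 * a) ≠ 0 :=
      (Real.sin_pos_of_pos_of_lt_pi (by linarith) (by linarith)).ne'
    rw [← hdet] at hsin
    simp only [hsucc]
    generalize 2 * a * (j : ℕ) = s at hsin
    generalize s + 2 * a = t at hsin
    refine ⟨(w.1 * Real.sin t - w.2 * Real.cos t) /
        (Real.cos s * Real.sin t - Real.sin s * Real.cos t),
      (w.2 * Real.cos s - w.1 * Real.sin s) /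
        (Real.cos s * Real.sin t - Real.sin s * Real.cos t), Prod.ext ?_ ?_⟩
    · simp only [c, Prod.fst_add, Prod.smul_fst, smul_eq_mul]
      rw [div_mul_eq_mul_div, div_mul_eq_mul_div, ← add_div, div_eq_iff hsin]
      ring
    · simp only [c, Prod.snd_add, Prod.smul_snd, smul_eq_mul]
      rw [div_mul_eq_mul_div, div_mul_eq_mul_div, ← add_div, div_eq_iff hsin]
      ring

namespace Polygon

variable {k : ℕ} (P : Polygon k)

theorem edge_le (j l : Fin (k + 3)) : P.edge j (P.vertex l) ≤ 1 := by
  by_cases h₁ : l = j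
  · rw [h₁, P.edge_left]
  by_cases h₂ : l = j + 1
  · rw [h₂, P.edge_right]
  exact (P.edge_lt j l h₁ h₂).le

theorem edge_sum (j : Fin (k + 3)) (y : Fin (k + 3) → ℝ) :
    P.edge j (∑ l, y l • P.vertex l) = ∑ l, y l * P.edge j (P.vertex l) := by
  simp [map_sum]

theorem edge_sum_le {y : Fin (k + 3) → ℝ} (hy : ∀ l, 0 ≤ y l) (j : Fin (k + 3)) :
    P.edge j (∑ l, y l • P.vertex l) ≤ ∑ l, y l := by
  rw [P.edge_sum]
  exact sum_le_sum fun l _ => mul_le_of_le_one_right (hy l) (P.edge_le j l)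

theorem edge_sum_eq_iff {y : Fin (k + 3) → ℝ} (hy : ∀ l, 0 ≤ y l) (j : Fin (k + 3)) :
    P.edge j (∑ l, y l • P.vertex l) = ∑ l, y l ↔ ∀ l, l ≠ j → l ≠ j + 1 → y l = 0 := by
  rw [P.edge_sum, sum_eq_sum_iff_of_le
    (fun l _ => mul_le_of_le_one_right (hy l) (P.edge_le j l))]
  refine forall_congr' fun l => ⟨fun h h₁ h₂ => ?_, fun h _ => ?_⟩
  · have := P.edge_lt j l h₁ h₂
    have h' := h (mem_univ _)
    by_contra hne
    exact this.ne (mul_left_cancel₀ hne (by rw [h', mul_one]))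
  · by_cases h₁ : l = j
    · rw [h₁, P.edge_left, mul_one]
    by_cases h₂ : l = j + 1
    · rw [h₂, P.edge_right, mul_one]
    rw [h h₁ h₂, zero_mul]

theorem sum_eq_of_support {M : Type*} [AddCommMonoid M] {j : Fin (k + 3)} {g : Fin (k + 3) → M}
    (hg : ∀ l, l ≠ j → l ≠ j + 1 → g l = 0) : ∑ l, g l = g j + g (j + 1) := by
  rw [← sum_subset (subset_univ {j, j + 1}), sum_pair (fin_add_one_ne j).symm]
  intro l _ hl
  simp only [mem_insert, mem_singleton, not_or] at hl
  exact hg l hl.1 hl.2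

/-- The cones over the edges overlap only along common faces. The functional of edge `i` reads off
the total weight of `y` and is at most that of `z`; by symmetry the totals agree. Equality then
forces `z` to be supported on edge `i` as well, where the functionals `i` and `i + 1` separate the
two coefficients. -/
theorem eq_of_sum_eq {y z : Fin (k + 3) → ℝ} (hy : ∀ l, 0 ≤ y l) (hz : ∀ l, 0 ≤ z l)
    {i j : Fin (k + 3)} (hyi : ∀ l, l ≠ i → l ≠ i + 1 → y l = 0)
    (hzj : ∀ l, l ≠ j → l ≠ j + 1 → z l = 0)
    (h : ∑ l, y l • P.vertex l = ∑ l, z l • P.vertex l) : y = z := by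
  have h₁ := P.edge_sum_le hz i
  have h₂ := P.edge_sum_le hy j
  have h₃ := (P.edge_sum_eq_iff hy i).mpr hyi
  have h₄ := (P.edge_sum_eq_iff hz j).mpr hzj
  rw [h] at h₂ h₃
  have hzi := (P.edge_sum_eq_iff hz i).mp (by linarith)
  have hu : ∀ l, l ≠ i → l ≠ i + 1 → (y l - z l) = 0 := fun l hl hl' => by
    rw [hyi l hl hl', hzi l hl hl', sub_zero]
  have hsum : (y i - z i) • P.vertex i + (y (i + 1) - z (i + 1)) • P.vertex (i + 1) = 0 := by
    rw [← sum_eq_of_support (g := fun l => (y l - z l) • P.vertex l)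
      fun l hl hl' => by rw [hu l hl hl', zero_smul]]
    simp only [sub_smul, sum_sub_distrib, h, sub_self]
  have e₁ := congrArg (P.edge i) hsum
  have e₂ := congrArg (P.edge (i + 1)) hsum
  simp only [map_add, map_smul, smul_eq_mul, P.edge_left, P.edge_right, mul_one, map_zero]
    at e₁ e₂
  have hlt := P.edge_lt (i + 1) i (fin_add_one_ne i).symm (fin_add_one_add_one_ne i).symm
  have hyz : y i = z i := by
    have : (y i - z i) * (1 - P.edge (i + 1) (P.vertex i)) = 0 := by linarith
    rcases mul_eq_zero.mp this with h | h <;> linarith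
  funext l
  by_cases hl : l = i
  · rw [hl, hyz]
  by_cases hl' : l = i + 1
  · rw [hl']
    linarith
  exact sub_eq_zero.mp (hu l hl hl')

/-- The cones over the edges cover the plane: `w` lies in the cone over an edge `j` whose functional
is maximal at `w`. In the basis of its endpoints that maximum is `α + β`; comparison with edge `j +
1` gives `0 ≤ α`, and with edge `j - 1` gives `0 ≤ β`. -/
theorem exists_sum_eq (w : ℝ × ℝ) : ∃ y : Fin (k + 3) → ℝ, (∀ l, 0 ≤ y l) ∧
    (∃ j, ∀ l, l ≠ j → l ≠ j + 1 → y l = 0) ∧ ∑ l, y l • P.vertex l = w := by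
  obtain ⟨j, hj⟩ := Finite.exists_max fun j => P.edge j w
  obtain ⟨α, β, rfl⟩ := P.span j w
  simp only [map_add, map_smul, smul_eq_mul, P.edge_left, P.edge_right, mul_one] at hj
  have hα : 0 ≤ α := by
    have h := hj (j + 1)
    rw [P.edge_left] at h
    have := P.edge_lt (j + 1) j (fin_add_one_ne j).symm (fin_add_one_add_one_ne j).symm
    nlinarith
  have hβ : 0 ≤ β := by
    have h := hj (j - 1)
    have e := P.edge_right (j - 1)
    have := P.edge_lt (j - 1) (j + 1)
      (fun h => fin_add_one_add_one_ne (j - 1) (by rw [sub_add_cancel, h]))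
      (by rw [sub_add_cancel]; exact fin_add_one_ne j)
    rw [sub_add_cancel] at e
    rw [e] at h
    nlinarith
  have hy : ∀ l, l ≠ j → l ≠ j + 1 →
      (Pi.single j α + Pi.single (j + 1) β : Fin (k + 3) → ℝ) l = 0 := fun l hl hl' => by
    simp [hl, hl']
  refine ⟨Pi.single j α + Pi.single (j + 1) β, fun l => ?_, ⟨j, hy⟩, ?_⟩
  · have h₁ : (0 : Fin (k + 3) → ℝ) ≤ Pi.single j α := Pi.single_nonneg.mpr hα
    have h₂ : (0 : Fin (k + 3) → ℝ) ≤ Pi.single (j + 1) β := Pi.single_nonneg.mpr hβ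
    exact add_nonneg (h₁ l) (h₂ l)
  · rw [sum_eq_of_support fun l hl hl' => by rw [hy l hl hl', zero_smul]]
    simp

end Polygon

end Polygon

/-! ### Realizations in barycentric coordinates -/

section Realization

variable {V : Type} [Fintype V]

/-- The realization is a finite union of closed faces of the standard simplex. -/
theorem isCompact_realization (K : PreAbstractSimplicialComplex V) :
    IsCompact (realization K) := by
  have h : realization K = ⋃ s : K.faces, stdSimplex ℝ V ∩ {x | ∀ v ∉ s.1, x v = 0} := by
    ext x
    simp only [realization, Set.mem_ofPred_eq, Set.mem_iUnion, Set.mem_inter_iff]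
    constructor
    · rintro ⟨hx, hs⟩
      exact ⟨⟨_, hs⟩, hx, fun v hv => by simpa using hv⟩
    · rintro ⟨⟨s, hs⟩, hx, h⟩
      refine ⟨hx, (K.isRelLowerSet_faces hs).2 (fun v hv => ?_) ?_⟩
      · by_contra hvs
        simp [h v hvs] at hv
      · by_contra hne
        have h0 : ∀ v, x v = 0 := by simpa [Finset.filter_eq_empty_iff] using hne
        have := hx.2
        simp [h0] at this
  rw [h]
  refine isCompact_iUnion fun s => (isCompact_stdSimplex ℝ V).inter_right ?_
  simp only [Set.ofPred_forall]
  exact isClosed_iInter fun v => isClosed_iInter fun _ =>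
    isClosed_eq (continuous_apply v) continuous_const

theorem sum_eq_sum_inl_add_sum_inr {d k : ℕ} (E : Fin d ⊕ Fin (k + 3) ≃ V) (x : V → ℝ) :
    ∑ v, x v = ∑ i, x (E (.inl i)) + ∑ j, x (E (.inr j)) := by
  rw [← E.sum_comp, Fintype.sum_sum_type]

variable [DecidableEq V]

theorem mem_realization_closure {F : Set (Finset V)} {x : V → ℝ} :
    x ∈ realization (closure F) ↔ x ∈ stdSimplex ℝ V ∧ ∃ t ∈ F, ∀ v ∉ t, x v = 0 := by
  constructor
  · rintro ⟨hx, -, t, ht, hs⟩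
    refine ⟨hx, t, ht, fun v hv => ?_⟩
    by_contra hne
    exact hv (hs (by simpa using hne))
  · rintro ⟨hx, t, ht, h⟩
    refine ⟨hx, ?_, t, ht, fun v hv => ?_⟩
    · by_contra hne
      have h0 : ∀ v, x v = 0 := by simpa [Finset.filter_eq_empty_iff] using hne
      have := hx.2
      simp [h0] at this
    · by_contra hvs
      simp [h v hvs] at hv

variable {d k : ℕ}

theorem mem_realization_joinBall (E : Fin d ⊕ Fin (k + 3) ≃ V) {x : V → ℝ} :
    x ∈ realization (joinBall E) ↔ x ∈ stdSimplex ℝ V ∧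
      ∃ j, ∀ l, l ≠ j → l ≠ j + 1 → x (E (.inr l)) = 0 := by
  rw [joinBall, mem_realization_closure, Set.exists_range_iff]
  refine and_congr_right fun _ => exists_congr fun j => ?_
  rw [E.forall_congr_right.symm, Sum.forall]
  simp

theorem mem_realization_joinSphere (E : Fin d ⊕ Fin (k + 3) ≃ V) {x : V → ℝ} :
    x ∈ realization (joinSphere E) ↔
      x ∈ realization (joinBall E) ∧ ∃ i, x (E (.inl i)) = 0 := by
  rw [mem_realization_joinBall, joinSphere, mem_realization_closure, Set.exists_range_iff,
    and_assoc, Prod.exists]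
  refine and_congr_right fun _ => ?_
  have : ∀ (i : Fin d) (j : Fin (k + 3)), (∀ v ∉ joinSphereFacet E (i, j), x v = 0) ↔
      (∀ l, l ≠ j → l ≠ j + 1 → x (E (.inr l)) = 0) ∧ x (E (.inl i)) = 0 := fun i j => by
    rw [E.forall_congr_right.symm, Sum.forall, and_comm]
    simp [joinSphereFacet]
  simp only [this]
  grind

end Realization

/-! ### The join as a ball and its boundary as a sphere -/

section JoinTopology

variable {d k : ℕ} (P : Polygon k)

/-- The inequalities of the free sum of a simplex, one of whose vertices is at the origin, and
a polygon. -/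
noncomputable def joinFunctional : Fin d ⊕ Fin (k + 3) → ((Fin d → ℝ) × (ℝ × ℝ)) →L[ℝ] ℝ
  | .inl i => -((ContinuousLinearMap.proj i).comp (ContinuousLinearMap.fst ℝ _ _))
  | .inr j => (∑ i, ContinuousLinearMap.proj i).comp (ContinuousLinearMap.fst ℝ _ _) +
      (P.edge j).comp (ContinuousLinearMap.snd ℝ _ _)

@[simp]
theorem joinFunctional_inl (i : Fin d) (y : (Fin d → ℝ) × (ℝ × ℝ)) :
    joinFunctional P (.inl i) y = -y.1 i := by
  simp [joinFunctional]

@[simp]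
theorem joinFunctional_inr (j : Fin (k + 3)) (y : (Fin d → ℝ) × (ℝ × ℝ)) :
    joinFunctional P (.inr j) y = ∑ i, y.1 i + P.edge j y.2 := by
  simp [joinFunctional]

theorem joinFunctional_ne_zero (i : Fin d ⊕ Fin (k + 3)) : joinFunctional P i ≠ 0 := by
  intro h
  rcases i with i | j
  · simpa using DFunLike.congr_fun h (Pi.single i 1, 0)
  · simpa [P.edge_left] using DFunLike.congr_fun h (0, P.vertex j)

/-- The free sum of a simplex and a polygon. -/
def joinPolytope (d : ℕ) : Set ((Fin d → ℝ) × (ℝ × ℝ)) :=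
  ⋂ i, joinFunctional P i ⁻¹' Set.Iic (Sum.elim 0 1 i)

theorem mem_joinPolytope {y : (Fin d → ℝ) × (ℝ × ℝ)} : y ∈ joinPolytope P d ↔
    (∀ i, 0 ≤ y.1 i) ∧ ∀ j, ∑ i, y.1 i + P.edge j y.2 ≤ 1 := by
  simp [joinPolytope]

theorem mem_frontier_joinPolytope {y : (Fin d → ℝ) × (ℝ × ℝ)} :
    y ∈ frontier (joinPolytope P d) ↔ y ∈ joinPolytope P d ∧
      ((∃ i, y.1 i = 0) ∨ ∃ j, ∑ i, y.1 i + P.edge j y.2 = 1) := by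
  rw [joinPolytope, frontier_iInter_preimage_Iic _ (joinFunctional_ne_zero P)]
  simp

theorem convex_joinPolytope : Convex ℝ (joinPolytope P d) :=
  convex_iInter fun i => (convex_Iic _).linear_preimage (joinFunctional P i).toLinearMap

theorem interior_joinPolytope_nonempty : (interior (joinPolytope P d)).Nonempty := by
  have h1 : (0 : ℝ) < d + 1 := by positivity
  have h2 : (d : ℝ) * ((d : ℝ) + 1)⁻¹ < 1 := by
    rw [← div_eq_mul_inv, div_lt_one h1]
    linarith
  -- All inequalities are strict here, since the coordinates add up to `d / (d + 1) < 1`; hence the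
  -- point is not on the frontier.
  let y : (Fin d → ℝ) × (ℝ × ℝ) := (fun _ => ((d : ℝ) + 1)⁻¹, 0)
  have hy : y ∈ joinPolytope P d := by
    rw [mem_joinPolytope]
    exact ⟨fun _ => by positivity, fun _ => by simpa [y] using h2.le⟩
  refine ⟨y, ?_⟩
  by_contra h
  obtain ⟨-, ⟨i, hi⟩ | ⟨j, hj⟩⟩ := (mem_frontier_joinPolytope P).mp ⟨subset_closure hy, h⟩
  · exact (inv_pos.mpr h1).ne' hi
  · exact h2.ne (by simpa [y] using hj)

variable {V : Type} (E : Fin (d + 1) ⊕ Fin (k + 3) ≃ V)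

/-- The linear map on the realization of the join that sends the last vertex of the simplex to
the origin. -/
noncomputable def joinMap (x : V → ℝ) : (Fin d → ℝ) × (ℝ × ℝ) :=
  (fun i => x (E (.inl i.castSucc)), ∑ j, x (E (.inr j)) • P.vertex j)

theorem continuous_joinMap : Continuous (joinMap P E) := by
  unfold joinMap
  fun_prop

variable [Fintype V]

theorem sum_eq_one_of_mem_stdSimplex {x : V → ℝ} (hx : x ∈ stdSimplex ℝ V) :
    ∑ i : Fin d, x (E (.inl i.castSucc)) + x (E (.inl (Fin.last d))) + ∑ j, x (E (.inr j)) = 1 := by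
  rw [← Fin.sum_univ_castSucc (fun i => x (E (.inl i))), ← sum_eq_sum_inl_add_sum_inr, hx.2]

variable [DecidableEq V]

/-- The polygon fan recovers the cycle coordinates. The one coordinate that the map forgets follows
from the total being `1`. -/
theorem injOn_joinMap : Set.InjOn (joinMap P E) (realization (joinBall E)) := by
  intro x hx y hy h
  rw [mem_realization_joinBall] at hx hy
  obtain ⟨hx, i, hxi⟩ := hx
  obtain ⟨hy, j, hyj⟩ := hy
  have h₁ : ∀ i : Fin d, x (E (.inl i.castSucc)) = y (E (.inl i.castSucc)) := fun i =>
    congrFun (congrArg Prod.fst h) i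
  have h₂ := congrFun (P.eq_of_sum_eq (y := fun l => x (E (.inr l))) (z := fun l => y (E (.inr l)))
    (fun l => hx.1 _) (fun l => hy.1 _) hxi hyj (congrArg Prod.snd h))
  have h₃ : x (E (.inl (Fin.last d))) = y (E (.inl (Fin.last d))) := by
    have sx := sum_eq_one_of_mem_stdSimplex E hx
    have sy := sum_eq_one_of_mem_stdSimplex E hy
    simp only [h₁, h₂] at sx
    linarith
  funext v
  obtain ⟨i | l, rfl⟩ := E.surjective v
  · induction i using Fin.lastCases with
    | last => exact h₃
    | cast i => exact h₁ i
  · exact h₂ l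

theorem image_joinMap : joinMap P E '' realization (joinBall E) = joinPolytope P d := by
  ext y
  constructor
  · rintro ⟨x, hx, rfl⟩
    rw [mem_realization_joinBall] at hx
    rw [mem_joinPolytope]
    refine ⟨fun i => hx.1.1 _, fun j => ?_⟩
    have h := P.edge_sum_le (y := fun l => x (E (.inr l))) (fun l => hx.1.1 _) j
    have s := sum_eq_one_of_mem_stdSimplex E hx.1
    have := hx.1.1 (E (.inl (Fin.last d)))
    simp only [joinMap]
    linarith
  · intro hy
    rw [mem_joinPolytope] at hy
    obtain ⟨z, hz, ⟨j, hzj⟩, hzy⟩ := P.exists_sum_eq y.2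
    have hj := hy.2 j
    -- On its own edge the functional equals the total weight, so inequality `j` says precisely that
    -- the weight left for the vertex at the origin is nonnegative.
    rw [← hzy, (P.edge_sum_eq_iff hz j).mpr hzj] at hj
    let u : Fin (d + 1) ⊕ Fin (k + 3) → ℝ :=
      Sum.elim (Fin.snoc y.1 (1 - ∑ i, y.1 i - ∑ l, z l)) z
    refine ⟨u ∘ E.symm, ?_, ?_⟩
    · rw [mem_realization_joinBall]
      refine ⟨⟨fun v => ?_, ?_⟩, j, fun l hl hl' => by simpa [u] using hzj l hl hl'⟩
      · obtain ⟨i | l, rfl⟩ := E.surjective v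
        · induction i using Fin.lastCases with
          | last =>
            simp [u]
            linarith
          | cast i => simpa [u] using hy.1 i
        · simpa [u] using hz l
      · rw [sum_eq_sum_inl_add_sum_inr E, Fin.sum_univ_castSucc]
        simp [u]
        ring
    · refine Prod.ext ?_ ?_
      · funext i
        simp [joinMap, u]
      · simpa [joinMap, u] using hzy

/-- A vanishing coordinate at one of the first `d` simplex vertices makes a sign condition tight.
The last coordinate is the slack in the inequality of the edge carrying the point, and no edge
inequality has smaller slack, so it vanishes exactly when some edge inequality is tight. -/
theorem image_joinMap_joinSphere :
    joinMap P E '' realization (joinSphere E) = frontier (joinPolytope P d) := by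
  have key : ∀ x ∈ realization (joinBall E),
      (x ∈ realization (joinSphere E) ↔ joinMap P E x ∈ frontier (joinPolytope P d)) := by
    intro x hx
    rw [mem_realization_joinSphere, mem_frontier_joinPolytope, ← image_joinMap P E]
    simp only [hx, Set.mem_image_of_mem _ hx, true_and]
    rw [mem_realization_joinBall] at hx
    obtain ⟨hx, j, hj⟩ := hx
    have s := sum_eq_one_of_mem_stdSimplex E hx
    simp only [joinMap]
    constructor
    · rintro ⟨i, hi⟩
      induction i using Fin.lastCases with
      | last =>
        refine Or.inr ⟨j, ?_⟩
        rw [(P.edge_sum_eq_iff (y := fun l => x (E (.inr l))) (fun l => hx.1 _) j).mpr hj]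
        linarith
      | cast i => exact Or.inl ⟨i, hi⟩
    · rintro (⟨i, hi⟩ | ⟨i, hi⟩)
      · exact ⟨_, hi⟩
      · have h := P.edge_sum_le (y := fun l => x (E (.inr l))) (fun l => hx.1 _) i
        have := hx.1 (E (.inl (Fin.last d)))
        exact ⟨Fin.last d, by linarith⟩
  have hcl : frontier (joinPolytope P d) ⊆ joinPolytope P d := fun y hy =>
    ((mem_frontier_joinPolytope P).mp hy).1
  ext y
  constructor
  · rintro ⟨x, hx, rfl⟩
    exact (key x ((mem_realization_joinSphere E).mp hx).1).mp hx
  · intro hy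
    obtain ⟨x, hx, rfl⟩ := (image_joinMap P E).symm ▸ hcl hy
    exact ⟨x, (key x hx).mpr hy, rfl⟩

theorem isSimplicialBall_joinBall_and_isSimplicialSphere_joinSphere :
    IsSimplicialBall (d + 1 + 1) (joinBall E) ∧ IsSimplicialSphere (d + 1) (joinSphere E) := by
  obtain ⟨P⟩ := nonempty_polygon k
  have him := image_joinMap P E
  exact nonempty_homeomorph_of_image_convex (by simp) (continuous_joinMap P E)
    (isCompact_realization _) (fun x hx => ((mem_realization_joinSphere E).mp hx).1)
    (injOn_joinMap P E) (him ▸ convex_joinPolytope P) (him ▸ interior_joinPolytope_nonempty P)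
    (him ▸ image_joinMap_joinSphere P E)

end JoinTopology

/-! ### Face posets of generated complexes -/

section FacePosets

variable {V W : Type} [DecidableEq W]

/-- A poset that is represented by the nonempty subsets of a set with `D + 1` elements is the face
poset of a `D`-simplex. -/
theorem nonempty_orderIso_simplexPoset [DecidableEq V] {P : Type} [PartialOrder P]
    (r : P → Finset V) (hr : ∀ a b, a ≤ b ↔ r a ⊆ r b) {t : Finset V} {D : ℕ} (ht : t.card = D + 1)
    (hrange : ∀ s, (∃ a, r a = s) ↔ s.Nonempty ∧ s ⊆ t) : Nonempty (P ≃o SimplexPoset D) := by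
  have φ : Fin (D + 1) ≃ t := (t.equivFinOfCardEq ht).symm
  have hmem : ∀ a, (r a).Nonempty ∧ r a ⊆ t := fun a => (hrange _).mp ⟨a, rfl⟩
  have hφ : ∀ a, ∀ v ∈ r a, ∃ i, (φ i : V) = v := fun a v hv =>
    ⟨φ.symm ⟨v, (hmem a).2 hv⟩, by simp⟩
  let f : P → SimplexPoset D := fun a => ⟨univ.filter (fun i => (φ i : V) ∈ r a), by
    obtain ⟨v, hv⟩ := (hmem a).1
    obtain ⟨i, rfl⟩ := hφ a v hv
    exact ⟨i, by simpa using hv⟩⟩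
  have hf : ∀ a b, f a ≤ f b ↔ a ≤ b := fun a b => by
    rw [hr, ← Subtype.coe_le_coe]
    constructor
    · intro h v hv
      obtain ⟨i, rfl⟩ := hφ a v hv
      have := h (show i ∈ (f a).1 by simpa [f] using hv)
      simpa [f] using this
    · intro h i hi
      simp only [f, mem_filter, mem_univ, true_and] at hi ⊢
      exact h hi
  refine ⟨RelIso.ofSurjective (OrderEmbedding.ofMapLEIff f hf) fun s => ?_⟩
  obtain ⟨a, ha⟩ := (hrange (s.1.image fun i => (φ i : V))).mpr
    ⟨s.2.image _, image_subset_iff.mpr fun i _ => (φ i).2⟩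
  refine ⟨a, Subtype.ext ?_⟩
  ext i
  simp [f, ha]

theorem nonempty_Iic_orderIso_simplexPoset [DecidableEq V]
    (K : PreAbstractSimplicialComplex V) (t : K.faces) {D : ℕ} (ht : t.1.card = D + 1) :
    Nonempty (Set.Iic t ≃o SimplexPoset D) := by
  refine nonempty_orderIso_simplexPoset (fun s => s.1.1) (fun _ _ => Iff.rfl) ht fun s => ?_
  constructor
  · rintro ⟨a, rfl⟩
    exact ⟨(K.isRelLowerSet_faces a.1.2).1, a.2⟩
  · rintro ⟨hs, hst⟩
    exact ⟨⟨⟨s, (K.isRelLowerSet_faces t.2).2 hst hs⟩, hst⟩, rfl⟩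

theorem covBy_of_card {K : PreAbstractSimplicialComplex V} {s t : K.faces} (hst : s.1 ⊆ t.1)
    (hcard : s.1.card + 1 = t.1.card) : s ⋖ t := by
  refine ⟨lt_of_le_of_ne hst fun h => ?_, fun c hsc hct => ?_⟩
  · rw [h] at hcard
    omega
  · have h₁ : s.1.card < c.1.card := card_lt_card hsc
    have h₂ : c.1.card < t.1.card := card_lt_card hct
    omega

theorem isMax_iff_mem_facets {K : PreAbstractSimplicialComplex V} {s : K.faces} :
    IsMax s ↔ s.1 ∈ facets K :=
  ⟨fun h => ⟨s.2, fun t ht hst => h (b := ⟨t, ht⟩) hst⟩, fun h t hst => h.2 t.2 hst⟩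

theorem isBoundaryRidge_closure {F : Set (Finset V)} {D : ℕ} (hF : ∀ s ∈ F, s.card = D + 1)
    {s : (closure F).faces} (hs : s.1.card = D) {t : Finset V} (ht : t ∈ F) (hst : s.1 ⊆ t)
    (huniq : ∀ t' ∈ F, s.1 ⊆ t' → t' = t) : IsBoundaryRidge s := by
  have htf : t ∈ facets (closure F) := by rwa [facets_closure hF]
  refine ⟨⟨t, htf.1⟩, isMax_iff_mem_facets.mpr htf, covBy_of_card hst ?_, fun m hm hsm => ?_⟩
  · rw [hs, hF t ht]
  · rw [isMax_iff_mem_facets, facets_closure hF] at hm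
    exact Subtype.ext (huniq _ hm hsm)

/-- A simplicial map that is injective on a simplex maps its face poset isomorphically. -/
theorem exists_Iic_orderIso_of_injOn {K : PreAbstractSimplicialComplex V}
    {L : PreAbstractSimplicialComplex W} (g : V → W) (q : K.faces → L.faces)
    (hq : ∀ s, (q s).1 = s.1.image g) (s : K.faces) (hinj : Set.InjOn g s.1) :
    ∃ e : Set.Iic s ≃o Set.Iic (q s), ∀ y : Set.Iic s, (e y : L.faces) = q y := by
  let f : Set.Iic s → Set.Iic (q s) := fun y => ⟨q y, by
    change (q y).1 ⊆ (q s).1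
    rw [hq, hq]
    exact image_subset_image y.2⟩
  have hf : ∀ a b, f a ≤ f b ↔ a ≤ b := fun a b => by
    change (q a).1 ⊆ (q b).1 ↔ a.1.1 ⊆ b.1.1
    rw [hq, hq]
    refine ⟨fun h v hv => ?_, image_subset_image⟩
    obtain ⟨w, hw, hwv⟩ := mem_image.mp (h (mem_image_of_mem g hv))
    exact hinj (b.2 hw) (a.2 hv) hwv ▸ hw
  refine ⟨RelIso.ofSurjective (OrderEmbedding.ofMapLEIff f hf) fun t => ?_, fun _ => rfl⟩
  have ht : t.1.1 ⊆ s.1.image g := hq s ▸ t.2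
  obtain ⟨u, hu, hut⟩ := subset_image_iff.mp ht
  have hne : u.Nonempty := image_nonempty.mp (hut ▸ (L.isRelLowerSet_faces t.1.2).1)
  refine ⟨⟨⟨u, (K.isRelLowerSet_faces s.2).2 hu hne⟩, hu⟩, Subtype.ext (Subtype.ext ?_)⟩
  exact (hq _).trans hut

end FacePosets

/-! ### Stacking simplices along a path -/

section Path

variable {d : ℕ}

/-- The facets of the join of the simplex on `d` vertices and an infinite path. -/
def pathFacet (d j : ℕ) : Finset (Fin d ⊕ ℕ) := univ.image .inl ∪ {.inr j, .inr (j + 1)}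

/-- The join of the simplex on `d` vertices and the path with `k` edges. -/
def pathBall (d k : ℕ) : PreAbstractSimplicialComplex (Fin d ⊕ ℕ) :=
  closure (pathFacet d '' Set.Iio k)

/-- The join of the simplex on `d` vertices and a vertex of the path. -/
def pathRidge (d j : ℕ) : Finset (Fin d ⊕ ℕ) := insert (.inr j) (univ.image .inl)

@[simp]
theorem inl_mem_pathFacet (i : Fin d) (j : ℕ) : .inl i ∈ pathFacet d j := by
  simp [pathFacet]

@[simp]
theorem inr_mem_pathFacet (l j : ℕ) : .inr l ∈ pathFacet d j ↔ l = j ∨ l = j + 1 := by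
  simp [pathFacet]

@[simp]
theorem inl_mem_pathRidge (i : Fin d) (j : ℕ) : .inl i ∈ pathRidge d j := by
  simp [pathRidge]

@[simp]
theorem inr_mem_pathRidge (l j : ℕ) : .inr l ∈ pathRidge d j ↔ l = j := by
  simp [pathRidge]

theorem card_pathRidge (d j : ℕ) : (pathRidge d j).card = d + 1 := by
  rw [pathRidge, card_insert_of_notMem (by simp), card_image_of_injective _ Sum.inl_injective]
  simp

theorem card_pathFacet (d j : ℕ) : (pathFacet d j).card = d + 1 + 1 := by
  rw [pathFacet, card_union_of_disjoint (by simp [disjoint_left]),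
    card_image_of_injective _ Sum.inl_injective, card_pair (by simp)]
  simp

theorem pathRidge_subset_pathFacet_iff (l j : ℕ) :
    pathRidge d l ⊆ pathFacet d j ↔ l = j ∨ l = j + 1 := by
  constructor
  · intro h
    have := h (show .inr l ∈ pathRidge d l by simp)
    simpa using this
  · rintro h (i | a) ha
    · simp
    · rw [inr_mem_pathRidge] at ha
      rwa [ha, inr_mem_pathFacet]

theorem card_of_mem_pathFacet_image (k : ℕ) :
    ∀ s ∈ pathFacet d '' Set.Iio k, s.card = d + 1 + 1 := by
  rintro _ ⟨j, -, rfl⟩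
  exact card_pathFacet d j

theorem pathRidge_mem_faces {k l j : ℕ} (hj : j < k) (hl : l = j ∨ l = j + 1) :
    pathRidge d l ∈ (pathBall d k).faces :=
  ⟨⟨.inr l, by simp⟩, _, ⟨j, hj, rfl⟩, (pathRidge_subset_pathFacet_iff l j).mpr hl⟩

theorem pathFacet_mem_faces {k j : ℕ} (hj : j < k) : pathFacet d j ∈ (pathBall d k).faces :=
  ⟨⟨.inr j, by simp⟩, _, ⟨j, hj, rfl⟩, Subset.rfl⟩

theorem isBoundaryRidge_pathRidge {k l j : ℕ} (hj : j < k) (hl : l = j ∨ l = j + 1)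
    (huniq : ∀ j' < k, l = j' ∨ l = j' + 1 → j' = j) :
    IsBoundaryRidge (⟨pathRidge d l, pathRidge_mem_faces hj hl⟩ : (pathBall d k).faces) := by
  refine isBoundaryRidge_closure (card_of_mem_pathFacet_image k) (card_pathRidge d l)
    ⟨j, hj, rfl⟩ ((pathRidge_subset_pathFacet_iff l j).mpr hl) ?_
  rintro _ ⟨j', hj', rfl⟩ h
  rw [huniq j' hj' ((pathRidge_subset_pathFacet_iff l j').mp h)]

/-- The new facet meets the earlier ones only in path vertex `k + 1` and the simplex vertices, that
is, in the end ridge of the stack. -/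
theorem gluesNewSimplex_pathBall (d k : ℕ) :
    GluesNewSimplex (d + 1) (pathBall d (k + 1)).faces (pathBall d (k + 2)).faces := by
  have hsub : (pathBall d (k + 1)).faces ⊆ (pathBall d (k + 2)).faces := by
    rintro s ⟨hs, _, ⟨j, hj, rfl⟩, hst⟩
    exact ⟨hs, _, ⟨j, Nat.lt_succ_of_lt hj, rfl⟩, hst⟩
  refine ⟨OrderEmbedding.ofMapLEIff (Set.inclusion hsub) fun _ _ => Iff.rfl,
    ⟨_, pathRidge_mem_faces (l := k + 1) (Nat.lt_succ_self k) (Or.inr rfl)⟩,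
    ⟨_, pathFacet_mem_faces (j := k + 1) (Nat.lt_succ_self _)⟩,
    isBoundaryRidge_pathRidge (Nat.lt_succ_self k) (Or.inr rfl) fun j' hj' h => by omega,
    nonempty_Iic_orderIso_simplexPoset _ _ (card_pathFacet d (k + 1)), ?_, ?_, ?_⟩
  · rintro _ t hts ⟨s, rfl⟩
    have ht := ((pathBall d (k + 2)).isRelLowerSet_faces t.2).1
    exact ⟨⟨t.1, ((pathBall d (k + 1)).isRelLowerSet_faces s.2).2 hts ht⟩, rfl⟩
  · rw [Set.eq_univ_iff_forall]
    rintro ⟨s, hs, _, ⟨j, hj, rfl⟩, hst⟩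
    rcases Nat.lt_succ_iff_lt_or_eq.mp (Set.mem_Iio.mp hj) with h | rfl
    · exact Or.inl ⟨⟨s, hs, _, ⟨j, h, rfl⟩, hst⟩, rfl⟩
    · exact Or.inr hst
  · ext t
    constructor
    · rintro ⟨⟨⟨s, hs, _, ⟨j, hj, rfl⟩, hsj⟩, rfl⟩, hst⟩
      rintro (i | l) hv
      · exact inl_mem_pathRidge _ _
      · have h₁ := hsj hv
        have h₂ := hst hv
        rw [inr_mem_pathFacet] at h₁ h₂
        rw [Set.mem_Iio] at hj
        exact (inr_mem_pathRidge _ _).mpr (by omega)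
    · intro h
      have ht := ((pathBall d (k + 2)).isRelLowerSet_faces t.2).1
      have hr := pathRidge_mem_faces (d := d) (l := k + 1) (Nat.lt_succ_self k) (Or.inr rfl)
      exact ⟨⟨⟨t.1, ((pathBall d (k + 1)).isRelLowerSet_faces hr).2 h ht⟩, rfl⟩,
        Finset.Subset.trans h ((pathRidge_subset_pathFacet_iff _ _).mpr (Or.inl rfl))⟩

theorem locallyConstructed_pathBall (d k : ℕ) :
    LocallyConstructed (d + 1) (pathBall d (k + 1)).faces := by
  induction k with
  | zero =>
    obtain ⟨e⟩ : Nonempty ((pathBall d (0 + 1)).faces ≃o SimplexPoset (d + 1)) := by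
      refine nonempty_orderIso_simplexPoset (fun s => s.1) (fun _ _ => Iff.rfl)
        (card_pathFacet d 0) fun s => ⟨?_, ?_⟩
      · rintro ⟨⟨s, hs, _, ⟨j, hj, rfl⟩, hst⟩, rfl⟩
        obtain rfl : j = 0 := by simpa using hj
        exact ⟨hs, hst⟩
      · rintro ⟨hs, hst⟩
        exact ⟨⟨s, hs, _, ⟨0, by simp, rfl⟩, hst⟩, rfl⟩
    exact .simplex _ e
  | succ k ih => exact .glueNew _ _ ih (gluesNewSimplex_pathBall d k)

end Path

/-! ### Gluing the two ends of the path -/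

section ClosingTheCycle

variable {V : Type} {d k : ℕ} (E : Fin d ⊕ Fin (k + 3) ≃ V)

/-- The map that wraps a path around the cycle. -/
def wrap : Fin d ⊕ ℕ → V := E ∘ Sum.map id (Fin.ofNat (k + 3))

theorem fin_ofNat_add_one (j : ℕ) : Fin.ofNat (k + 3) (j + 1) = Fin.ofNat (k + 3) j + 1 := by
  ext
  simp [Fin.val_add]

theorem image_wrap_pathFacet [DecidableEq V] (j : ℕ) :
    (pathFacet d j).image (wrap E) = joinFacet E (Fin.ofNat (k + 3) j) := by
  rw [joinFacet, ← fin_ofNat_add_one]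
  simp [pathFacet, image_image, wrap, Function.comp_def]

theorem wrap_swap (v : Fin d ⊕ ℕ) :
    wrap E (Equiv.swap (.inr 0) (.inr (k + 3)) v) = wrap E v := by
  by_cases h₀ : v = .inr 0
  · subst h₀
    simp [wrap]
  by_cases h₁ : v = .inr (k + 3)
  · subst h₁
    simp [wrap]
  rw [Equiv.swap_apply_of_ne_of_ne h₀ h₁]

theorem wrap_inl_eq_iff {i : Fin d} {w : Fin d ⊕ ℕ} : wrap E w = wrap E (.inl i) ↔ w = .inl i := by
  rcases w with w | w <;> simp [wrap]

theorem wrap_inr_eq_iff {l : ℕ} {w : Fin d ⊕ ℕ} :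
    wrap E w = wrap E (.inr l) ↔ ∃ a, w = .inr a ∧ a % (k + 3) = l % (k + 3) := by
  rcases w with w | w <;> simp [wrap, Fin.ext_iff]

theorem mod_eq_mod_iff_of_le {m a b : ℕ} (ha : a ≤ m) (hb : b ≤ m) :
    a % m = b % m ↔ a = b ∨ (a = 0 ∧ b = m) ∨ (a = m ∧ b = 0) := by
  rcases ha.eq_or_lt with rfl | ha <;> rcases hb.eq_or_lt with rfl | hb
  · simp
  · rw [Nat.mod_self, Nat.mod_eq_of_lt hb]
    omega
  · rw [Nat.mod_self, Nat.mod_eq_of_lt ha]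
    omega
  · rw [Nat.mod_eq_of_lt ha, Nat.mod_eq_of_lt hb]
    omega

theorem le_of_inr_mem {s : Finset (Fin d ⊕ ℕ)} {j m l : ℕ} (hj : j < m) (hs : s ⊆ pathFacet d j)
    (hl : .inr l ∈ s) : l ≤ m := by
  have := hs hl
  rw [inr_mem_pathFacet] at this
  omega

/-- Among the path vertices `0, …, k + 3` only the two ends are identified, and no face contains
both, because path vertices of a face differ by at most one. -/
theorem injOn_wrap (s : (pathBall d (k + 3)).faces) : Set.InjOn (wrap E) s.1 := by
  obtain ⟨s, -, _, ⟨j, hj, rfl⟩, hs⟩ := s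
  rintro (i | l) hv (i' | l') hw h
  · exact (wrap_inl_eq_iff E).mp h
  · exact ((wrap_inl_eq_iff E).mp h.symm).symm
  · exact (wrap_inl_eq_iff E).mp h
  · obtain ⟨a, ha, hmod⟩ := (wrap_inr_eq_iff E).mp h
    obtain rfl : l = a := by simpa using ha
    rw [mod_eq_mod_iff_of_le (le_of_inr_mem hj hs hv) (le_of_inr_mem hj hs hw)] at hmod
    have h₁ := hs hv
    have h₂ := hs hw
    rw [inr_mem_pathFacet] at h₁ h₂
    rw [Set.mem_Iio] at hj
    congr 1
    omega

variable [DecidableEq V]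

/-- Two different faces of the path complex that are wrapped to the same face lie on the two end
ridges. -/
theorem subset_pathRidge_of_image_wrap_eq {s t : Finset (Fin d ⊕ ℕ)}
    (hs : s ∈ (pathBall d (k + 3)).faces) (ht : t ∈ (pathBall d (k + 3)).faces)
    (h : s.image (wrap E) = t.image (wrap E)) (hs0 : .inr 0 ∈ s) (ht0 : .inr (k + 3) ∈ t) :
    s ⊆ pathRidge d 0 ∧ s.image (Equiv.swap (.inr 0) (.inr (k + 3))) = t := by
  obtain ⟨-, _, ⟨a, ha, rfl⟩, hsa⟩ := hs
  obtain ⟨-, _, ⟨b, hb, rfl⟩, htb⟩ := ht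
  have ha0 := hsa hs0
  have hb0 := htb ht0
  rw [inr_mem_pathFacet] at ha0 hb0
  rw [Set.mem_Iio] at ha hb
  -- Only the first facet contains the start of the path, and only the last one contains its end.
  obtain rfl : a = 0 := by omega
  obtain rfl : b = k + 2 := by omega
  have h₁ : ∀ v ∈ s, ∃ w ∈ t, wrap E w = wrap E v := fun v hv =>
    mem_image.mp (h ▸ mem_image_of_mem _ hv)
  have h₂ : ∀ w ∈ t, ∃ v ∈ s, wrap E v = wrap E w := fun w hw =>
    mem_image.mp (h ▸ mem_image_of_mem _ hw)
  -- The only other candidate is vertex `1`, but the path vertices of `t` are among `k + 2` and `k +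
  -- 3`, and neither is wrapped to the same place as `1`.
  have hsr : ∀ l, .inr l ∈ s → l = 0 := fun l hl => by
    obtain ⟨w, hw, hwl⟩ := h₁ _ hl
    obtain ⟨c, rfl, hc⟩ := (wrap_inr_eq_iff E).mp hwl
    have e₁ := hsa hl
    have e₂ := htb hw
    rw [mod_eq_mod_iff_of_le (le_of_inr_mem hb htb hw) (le_of_inr_mem ha hsa hl)] at hc
    rw [inr_mem_pathFacet] at e₁ e₂
    omega
  have htr : ∀ l, .inr l ∈ t → l = k + 3 := fun l hl => by
    obtain ⟨w, hw, hwl⟩ := h₂ _ hl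
    obtain ⟨c, rfl, hc⟩ := (wrap_inr_eq_iff E).mp hwl
    have e₁ := hsr c hw
    have e₂ := htb hl
    rw [mod_eq_mod_iff_of_le (le_of_inr_mem ha hsa hw) (le_of_inr_mem hb htb hl)] at hc
    rw [inr_mem_pathFacet] at e₂
    omega
  refine ⟨?_, ?_⟩
  · rintro (i | l) hv
    · simp
    · rw [hsr l hv]
      simp
  · ext w
    rw [mem_image]
    constructor
    · rintro ⟨i | l, hv, rfl⟩
      · obtain ⟨w, hw, hwi⟩ := h₁ _ hv
        rw [(wrap_inl_eq_iff E).mp hwi] at hw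
        rwa [Equiv.swap_apply_of_ne_of_ne (by simp) (by simp)]
      · rw [hsr l hv, Equiv.swap_apply_left]
        exact ht0
    · intro hw
      rcases w with i | l
      · obtain ⟨v, hv, hvi⟩ := h₂ _ hw
        rw [(wrap_inl_eq_iff E).mp hvi] at hv
        exact ⟨_, hv, Equiv.swap_apply_of_ne_of_ne (by simp) (by simp)⟩
      · rw [htr l hw]
        exact ⟨_, hs0, Equiv.swap_apply_left _ _⟩

/-- The complementary case: when the two ends are not matched with each other, every vertex of `s`
can only be matched with itself. -/
theorem subset_of_image_wrap_eq {s t : Finset (Fin d ⊕ ℕ)}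
    (hs : s ∈ (pathBall d (k + 3)).faces) (ht : t ∈ (pathBall d (k + 3)).faces)
    (h : s.image (wrap E) = t.image (wrap E)) (h₁ : .inr 0 ∈ s → .inr (k + 3) ∉ t)
    (h₂ : .inr (k + 3) ∈ s → .inr 0 ∉ t) : s ⊆ t := by
  obtain ⟨-, _, ⟨a, ha, rfl⟩, hsa⟩ := hs
  obtain ⟨-, _, ⟨b, hb, rfl⟩, htb⟩ := ht
  intro v hv
  obtain ⟨w, hw, hwv⟩ := mem_image.mp (h ▸ mem_image_of_mem (wrap E) hv)
  rcases v with i | l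
  · rwa [(wrap_inl_eq_iff E).mp hwv] at hw
  · obtain ⟨c, rfl, hc⟩ := (wrap_inr_eq_iff E).mp hwv
    rw [mod_eq_mod_iff_of_le (le_of_inr_mem hb htb hw) (le_of_inr_mem ha hsa hv)] at hc
    rcases hc with rfl | ⟨rfl, rfl⟩ | ⟨rfl, rfl⟩
    · exact hw
    · exact absurd hw (h₂ hv)
    · exact absurd hw (h₁ hv)

theorem image_wrap_mem_faces {s : Finset (Fin d ⊕ ℕ)} (hs : s ∈ (pathBall d (k + 3)).faces) :
    s.image (wrap E) ∈ (joinBall E).faces := by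
  obtain ⟨hne, _, ⟨j, -, rfl⟩, hsj⟩ := hs
  exact ⟨hne.image _, _, ⟨_, rfl⟩, image_wrap_pathFacet E j ▸ image_subset_image hsj⟩

theorem image_swap_subset {s : Finset (Fin d ⊕ ℕ)} {a b : ℕ} (hs : s ⊆ pathRidge d a) :
    s.image (Equiv.swap (.inr a) (.inr b)) ⊆ pathRidge d b := by
  rw [image_subset_iff]
  rintro (i | l) hv
  · rw [Equiv.swap_apply_of_ne_of_ne (by simp) (by simp)]
    simp
  · obtain rfl := (inr_mem_pathRidge _ _).mp (hs hv)
    simp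

theorem image_swap_image_swap {W : Type*} [DecidableEq W] (s : Finset W) (a b : W) :
    (s.image (Equiv.swap a b)).image (Equiv.swap b a) = s := by
  rw [image_image, Equiv.swap_comm b a, ← Equiv.coe_trans]
  simp

theorem mem_faces_of_subset {W : Type*} {K : PreAbstractSimplicialComplex W} {s t : Finset W}
    (ht : t ∈ K.faces) (hst : s ⊆ t) (hs : s.Nonempty) : s ∈ K.faces :=
  (K.isRelLowerSet_faces ht).2 hst hs

/-- The reflection that maps the faces of one ridge to those of another one. -/
def pathRidgeSwap {K : PreAbstractSimplicialComplex (Fin d ⊕ ℕ)} {a b : ℕ}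
    (ha : pathRidge d a ∈ K.faces) (hb : pathRidge d b ∈ K.faces)
    (s : Set.Iic (⟨pathRidge d a, ha⟩ : K.faces)) : Set.Iic (⟨pathRidge d b, hb⟩ : K.faces) :=
  have hs : s.1.1 ⊆ pathRidge d a := s.2
  have hs' : s.1.1.image (Equiv.swap (.inr a) (.inr b)) ⊆ pathRidge d b := image_swap_subset hs
  ⟨⟨_, mem_faces_of_subset hb hs' ((K.isRelLowerSet_faces s.1.2).1.image _)⟩, hs'⟩

/-- The reflection that identifies the faces of two ridges in a complex. -/
def pathRidgeIso {K : PreAbstractSimplicialComplex (Fin d ⊕ ℕ)} {a b : ℕ}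
    (ha : pathRidge d a ∈ K.faces) (hb : pathRidge d b ∈ K.faces) :
    Set.Iic (⟨pathRidge d a, ha⟩ : K.faces) ≃o Set.Iic (⟨pathRidge d b, hb⟩ : K.faces) where
  toFun := pathRidgeSwap ha hb
  invFun := pathRidgeSwap hb ha
  left_inv s := Subtype.ext (Subtype.ext (image_swap_image_swap s.1.1 _ _))
  right_inv s := Subtype.ext (Subtype.ext (image_swap_image_swap s.1.1 _ _))
  map_rel_iff' {s t} := by
    change s.1.1.image _ ⊆ t.1.1.image _ ↔ s.1.1 ⊆ t.1.1
    exact image_subset_image_iff (Equiv.swap _ _).injective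

theorem gluesBoundaryPair_pathBall_joinBall (hd : 1 ≤ d) :
    GluesBoundaryPair (pathBall d (k + 3)).faces (joinBall E).faces := by
  have h0 : pathRidge d 0 ∈ (pathBall d (k + 3)).faces :=
    pathRidge_mem_faces (j := 0) (by omega) (by omega)
  have hk : pathRidge d (k + 3) ∈ (pathBall d (k + 3)).faces :=
    pathRidge_mem_faces (j := k + 2) (by omega) (by omega)
  -- The overlap of the two end ridges; it is a cell only if it is nonempty, hence `1 ≤ d`.
  let ρ : Finset (Fin d ⊕ ℕ) := univ.image .inl
  have hρcard : ρ.card = d := by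
    simp [ρ, card_image_of_injective _ Sum.inl_injective]
  have hρ : ∀ j, ρ ⊆ pathRidge d j := fun j => subset_insert _ _
  have hρne : ρ.Nonempty := card_pos.mp (by omega)
  have hρmem : ρ ∈ (pathBall d (k + 3)).faces :=
    ((pathBall d (k + 3)).isRelLowerSet_faces h0).2 (hρ 0) hρne
  let q : (pathBall d (k + 3)).faces → (joinBall E).faces := fun s =>
    ⟨s.1.image (wrap E), image_wrap_mem_faces E s.2⟩
  refine ⟨⟨_, h0⟩, ⟨_, hk⟩, ⟨ρ, hρmem⟩, pathRidgeIso h0 hk, q, ?_, ?_, ?_, ?_, ?_, ?_, ?_, ?_, ?_⟩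
  · intro h
    have h' : pathRidge d 0 = pathRidge d (k + 3) := congrArg Subtype.val h
    have : .inr 0 ∈ pathRidge d (k + 3) := h' ▸ (inr_mem_pathRidge 0 0).mpr rfl
    simp at this
  · exact isBoundaryRidge_pathRidge (j := 0) (by omega) (by omega) (by omega)
  · exact isBoundaryRidge_pathRidge (j := k + 2) (by omega) (by omega) (by omega)
  · exact covBy_of_card (hρ _) (by rw [card_pathRidge, hρcard])
  · exact covBy_of_card (hρ _) (by rw [card_pathRidge, hρcard])
  · rintro ⟨⟨s, hs⟩, hs0⟩ hsρ
    refine Subtype.ext ?_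
    change s.image _ = s
    rw [image_congr (g := id), image_id]
    intro v hv
    obtain ⟨i, -, rfl⟩ := mem_image.mp (hsρ hv)
    exact Equiv.swap_apply_of_ne_of_ne (by simp) (by simp)
  · rintro ⟨t, hne, _, ⟨j, rfl⟩, htj⟩
    have hj : Fin.ofNat (k + 3) (j : ℕ) = j := by simp
    rw [← hj, ← image_wrap_pathFacet] at htj
    obtain ⟨s, hs, rfl⟩ := subset_image_iff.mp htj
    exact ⟨⟨s, image_nonempty.mp hne, _, ⟨j, j.isLt, rfl⟩, hs⟩, rfl⟩
  · have hglue : ∀ z : Set.Iic (⟨_, h0⟩ : (pathBall d (k + 3)).faces),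
        q (pathRidgeIso h0 hk z) = q z := fun z => by
      refine Subtype.ext ?_
      change (z.1.1.image _).image (wrap E) = z.1.1.image (wrap E)
      rw [image_image]
      exact image_congr fun v _ => wrap_swap E v
    intro s t
    constructor
    · intro h
      have h' : s.1.image (wrap E) = t.1.image (wrap E) := congrArg Subtype.val h
      by_cases c₁ : .inr 0 ∈ s.1 ∧ .inr (k + 3) ∈ t.1
      · obtain ⟨hs, hst⟩ := subset_pathRidge_of_image_wrap_eq E s.2 t.2 h' c₁.1 c₁.2
        exact Or.inr (Or.inl ⟨⟨s, hs⟩, rfl, Subtype.ext hst⟩)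
      by_cases c₂ : .inr 0 ∈ t.1 ∧ .inr (k + 3) ∈ s.1
      · obtain ⟨ht, hts⟩ := subset_pathRidge_of_image_wrap_eq E t.2 s.2 h'.symm c₂.1 c₂.2
        exact Or.inr (Or.inr ⟨⟨t, ht⟩, rfl, Subtype.ext hts⟩)
      refine Or.inl (Subtype.ext (Subset.antisymm ?_ ?_))
      · exact subset_of_image_wrap_eq E s.2 t.2 h' (fun a b => c₁ ⟨a, b⟩) (fun a b => c₂ ⟨b, a⟩)
      · exact subset_of_image_wrap_eq E t.2 s.2 h'.symm (fun a b => c₂ ⟨a, b⟩)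
          (fun a b => c₁ ⟨b, a⟩)
    · rintro (rfl | ⟨z, rfl, rfl⟩ | ⟨z, rfl, rfl⟩)
      · rfl
      · exact (hglue z).symm
      · exact hglue z
  · exact fun s => exists_Iic_orderIso_of_injOn (wrap E) q (fun _ => rfl) s (injOn_wrap E s)

theorem locallyConstructed_joinBall (hd : 1 ≤ d) :
    LocallyConstructed (d + 1) (joinBall E).faces :=
  .gluePair _ _ (locallyConstructed_pathBall d (k + 2)) (gluesBoundaryPair_pathBall_joinBall E hd)

/-- The join of the boundary of a simplex and a cycle is a locally constructible sphere. -/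
theorem isLCSphere_joinSphere [Fintype V] (hd : 1 ≤ d) : IsLCSphere d (joinSphere E) := by
  -- The map to the polytope needs a simplex vertex to send to the origin.
  obtain ⟨d, rfl⟩ := Nat.exists_eq_add_of_le' hd
  let e := Fintype.equivFin V
  refine ⟨(isSimplicialBall_joinBall_and_isSimplicialSphere_joinSphere E).2, Fintype.card V,
    e.toEmbedding, joinBall (E.trans e),
    ⟨(isSimplicialBall_joinBall_and_isSimplicialSphere_joinSphere (E.trans e)).1,
      locallyConstructed_joinBall _ hd⟩, ?_⟩
  rw [boundary_joinBall]
  exact (map_joinSphere E e).symm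

end ClosingTheCycle

/-! ### Hamilton cycles, cyclic orders and relabellings -/

section Cycles

variable {n d k : ℕ}

theorem cycleGraph_adj_iff_exists {u v : Fin (k + 3)} :
    (SimpleGraph.cycleGraph (k + 3)).Adj u v ↔
      ∃ j, (u = j ∧ v = j + 1) ∨ (u = j + 1 ∧ v = j) := by
  rw [SimpleGraph.cycleGraph_adj, sub_eq_iff_eq_add', sub_eq_iff_eq_add']
  constructor
  · rintro (h | h)
    · exact ⟨v, Or.inr ⟨h, rfl⟩⟩
    · exact ⟨u, Or.inl ⟨rfl, h⟩⟩
  · rintro ⟨j, ⟨rfl, rfl⟩ | ⟨rfl, rfl⟩⟩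
    · exact Or.inr rfl
    · exact Or.inl rfl

/-- The bijection `c` lists the vertices of the cycle `C` in cyclic order. -/
def IsCyclicOrder (C : SimpleGraph (NonPole n d)) (c : Fin (k + 3) ≃ NonPole n d) : Prop :=
  ∀ x y, C.Adj x y ↔ ∃ j, (x = c j ∧ y = c (j + 1)) ∨ (x = c (j + 1) ∧ y = c j)

theorem IsHamiltonCycle.exists_isCyclicOrder {C : SimpleGraph (NonPole n d)}
    (hC : IsHamiltonCycle C) :
    ∃ k, n = d + (k + 3) ∧ ∃ c : Fin (k + 3) ≃ NonPole n d, IsCyclicOrder C c := by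
  obtain ⟨h3, ⟨e⟩⟩ := hC
  obtain ⟨k, hk⟩ : ∃ k, n - d = k + 3 := ⟨n - d - 3, by omega⟩
  rw [hk] at e
  refine ⟨k, by omega, e.symm.toEquiv, fun x y => ?_⟩
  rw [← e.map_adj_iff, cycleGraph_adj_iff_exists]
  simp [RelIso.eq_symm_apply]

theorem IsCyclicOrder.isHamiltonCycle {C : SimpleGraph (NonPole n d)}
    {c : Fin (k + 3) ≃ NonPole n d} (hc : IsCyclicOrder C c) (hn : n = d + (k + 3)) :
    IsHamiltonCycle C := by
  have hk : n - d = k + 3 := by omega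
  refine ⟨by omega, ?_⟩
  rw [hk]
  refine ⟨SimpleGraph.Iso.symm ⟨c, fun {u v} => ?_⟩⟩
  rw [hc, cycleGraph_adj_iff_exists]
  simp

/-- The vertices: the poles followed by the vertices of the cycle. -/
noncomputable def vertexEquiv (hn : n = d + (k + 3)) (c : Fin (k + 3) ≃ NonPole n d) :
    Fin d ⊕ Fin (k + 3) ≃ Fin n :=
  Equiv.ofBijective (Sum.elim (Fin.castLE (by omega)) (fun j => (c j).1)) (by
    constructor
    · rintro (i | j) (i' | j') h
      · simpa using h
      · have := (c j').2
        have h' := congrArg Fin.val h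
        simp only [Sum.elim_inl, Sum.elim_inr, Fin.val_castLE] at h'
        omega
      · have := (c j).2
        have h' := congrArg Fin.val h
        simp only [Sum.elim_inl, Sum.elim_inr, Fin.val_castLE] at h'
        omega
      · simpa [Subtype.coe_inj] using h
    · intro v
      by_cases hv : (v : ℕ) < d
      · exact ⟨.inl ⟨v, hv⟩, rfl⟩
      · exact ⟨.inr (c.symm ⟨v, not_lt.mp hv⟩), by simp⟩)

@[simp]
theorem val_vertexEquiv_inl (hn : n = d + (k + 3)) (c : Fin (k + 3) ≃ NonPole n d) (i : Fin d) :
    (vertexEquiv hn c (.inl i) : ℕ) = i := rfl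

@[simp]
theorem vertexEquiv_inr (hn : n = d + (k + 3)) (c : Fin (k + 3) ≃ NonPole n d)
    (j : Fin (k + 3)) : vertexEquiv hn c (.inr j) = (c j).1 := rfl

theorem poles_eq_image (hn : n = d + (k + 3)) (c : Fin (k + 3) ≃ NonPole n d) :
    poles n d = univ.image (fun i => vertexEquiv hn c (.inl i)) := by
  ext v
  simp only [poles, mem_filter, mem_univ, true_and, mem_image]
  constructor
  · exact fun hv => ⟨⟨v, hv⟩, rfl⟩
  · rintro ⟨i, rfl⟩
    simp

theorem fSet_comm (x y : NonPole n d) : fSet x y = fSet y x := by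
  rw [fSet, fSet, pair_comm]

theorem fSet_eq_joinFacet (hn : n = d + (k + 3)) (c : Fin (k + 3) ≃ NonPole n d)
    (j : Fin (k + 3)) : fSet (c j) (c (j + 1)) = joinFacet (vertexEquiv hn c) j := by
  rw [fSet, poles_eq_image hn c, joinFacet, vertexEquiv_inr, vertexEquiv_inr]

/-- Translates quantification over edges into quantification over cyclic indices; the orientation of
an edge is immaterial because `fSet` is symmetric. -/
theorem IsCyclicOrder.exists_adj_iff {C : SimpleGraph (NonPole n d)}
    {c : Fin (k + 3) ≃ NonPole n d} (hc : IsCyclicOrder C c) (hn : n = d + (k + 3))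
    (p : Finset (Fin n) → Prop) :
    (∃ x y, C.Adj x y ∧ p (fSet x y)) ↔ ∃ j, p (joinFacet (vertexEquiv hn c) j) := by
  constructor
  · rintro ⟨x, y, hxy, h⟩
    obtain ⟨j, ⟨rfl, rfl⟩ | ⟨rfl, rfl⟩⟩ := (hc x y).mp hxy
    · exact ⟨j, fSet_eq_joinFacet hn c j ▸ h⟩
    · exact ⟨j, fSet_eq_joinFacet hn c j ▸ fSet_comm (c j) _ ▸ h⟩
  · rintro ⟨j, h⟩
    exact ⟨c j, c (j + 1), (hc _ _).mpr ⟨j, Or.inl ⟨rfl, rfl⟩⟩,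
      (fSet_eq_joinFacet hn c j).symm ▸ h⟩

variable {C : SimpleGraph (NonPole n d)} {c : Fin (k + 3) ≃ NonPole n d}

theorem IsCyclicOrder.ballOf_eq (hc : IsCyclicOrder C c) (hn : n = d + (k + 3)) :
    ballOf C = joinBall (vertexEquiv hn c) := by
  unfold ballOf joinBall
  congr 1
  ext s
  rw [Set.mem_ofPred_eq, hc.exists_adj_iff hn (s = ·)]
  simp [eq_comm]

theorem IsCyclicOrder.sphereOf_eq (hc : IsCyclicOrder C c) (hn : n = d + (k + 3)) :
    sphereOf C = joinSphere (vertexEquiv hn c) := by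
  rw [sphereOf, hc.ballOf_eq hn, boundary_joinBall]

theorem IsCyclicOrder.facets_sphereOf (hc : IsCyclicOrder C c) (hn : n = d + (k + 3)) :
    facets (sphereOf C) =
      {s | ∃ x y, C.Adj x y ∧ ∃ v ∈ poles n d, s = (fSet x y).erase v} := by
  rw [hc.sphereOf_eq hn, facets_joinSphere]
  ext s
  rw [Set.mem_ofPred_eq, hc.exists_adj_iff hn (fun f => ∃ v ∈ poles n d, s = f.erase v),
    poles_eq_image hn c, exists_comm]
  simp [joinSphereFacet, eq_comm]

theorem IsCyclicOrder.iteratedCone_eq (hc : IsCyclicOrder C c) : ballOf C = iteratedCone C := by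
  have hne : {s : Finset (Fin n) | ∃ x y : NonPole n d, C.Adj x y ∧ s = {x.1, y.1}}.Nonempty :=
    ⟨_, c 0, c (0 + 1), (hc _ _).mpr ⟨0, Or.inl ⟨rfl, rfl⟩⟩, rfl⟩
  have hpoles : ((List.finRange n).filter (fun i : Fin n => (i : ℕ) < d)).toFinset =
      poles n d := by
    ext i
    simp [poles]
  rw [iteratedCone, graphComplex, foldr_cone_closure hne, hpoles, ballOf]
  congr 1
  ext s
  constructor
  · rintro ⟨x, y, hxy, rfl⟩
    exact ⟨_, ⟨x, y, hxy, rfl⟩, rfl⟩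
  · rintro ⟨_, ⟨x, y, hxy, rfl⟩, rfl⟩
    exact ⟨x, y, hxy, rfl⟩

/-- The vertices of the standard cycle in cyclic order. -/
def standardOrder (hn : n = d + (k + 3)) : Fin (k + 3) ≃ NonPole n d where
  toFun j := ⟨⟨d + j, by omega⟩, by simp⟩
  invFun x := ⟨x.1 - d, by omega⟩
  left_inv j := by simp
  right_inv x := by
    have := x.2
    ext
    simp only
    omega

@[simp]
theorem val_standardOrder (hn : n = d + (k + 3)) (j : Fin (k + 3)) :
    ((standardOrder hn j).1 : ℕ) = d + j := rfl

theorem isCyclicOrder_standardOrder (hn : n = d + (k + 3)) :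
    IsCyclicOrder (standardCycle n d) (standardOrder hn) := by
  intro x y
  obtain ⟨a, rfl⟩ := (standardOrder hn).surjective x
  obtain ⟨b, rfl⟩ := (standardOrder hn).surjective y
  have hk : n - d = k + 3 := by omega
  have key : ∀ a b : Fin (k + 3), (b : ℕ) = (a + 1) % (k + 3) ↔ b = a + 1 := fun a b => by
    rw [Fin.ext_iff, Fin.val_add]
    simp
  simp only [standardCycle, SimpleGraph.fromRel_adj, val_standardOrder, hk, add_tsub_cancel_left,
    key, EmbeddingLike.apply_eq_iff_eq, ne_eq]
  constructor
  · rintro ⟨-, rfl | rfl⟩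
    · exact ⟨a, Or.inl ⟨rfl, rfl⟩⟩
    · exact ⟨b, Or.inr ⟨rfl, rfl⟩⟩
  · rintro ⟨j, ⟨rfl, rfl⟩ | ⟨rfl, rfl⟩⟩
    · exact ⟨(fin_add_one_ne _).symm, Or.inl rfl⟩
    · exact ⟨fin_add_one_ne _, Or.inr rfl⟩

theorem add_sub_mod_eq_ite {i : ℕ} (hi : i < n) (hd : d ≤ n) :
    (i + (n - d)) % n = if i < d then i + (n - d) else i - d := by
  split_ifs with h
  · exact Nat.mod_eq_of_lt (by omega)
  · rw [show i + (n - d) = i - d + n by omega, Nat.add_mod_right, Nat.mod_eq_of_lt (by omega)]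

/-- The cyclic relabelling that moves the poles to the end. -/
theorem exists_perm_add_sub_mod (hd : d ≤ n) :
    ∃ e : Equiv.Perm (Fin n), ∀ i : Fin n, (e i : ℕ) = ((i : ℕ) + (n - d)) % n := by
  let f : Fin n → Fin n := fun i =>
    ⟨((i : ℕ) + (n - d)) % n, Nat.mod_lt _ (i.pos)⟩
  have hf : Function.Injective f := fun i j h => by
    have h' : ((i : ℕ) + (n - d)) % n = ((j : ℕ) + (n - d)) % n := congrArg Fin.val h
    rw [add_sub_mod_eq_ite i.isLt hd, add_sub_mod_eq_ite j.isLt hd] at h'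
    have := i.isLt
    have := j.isLt
    ext
    split_ifs at h' <;> omega
  exact ⟨Equiv.ofBijective f (Finite.injective_iff_bijective.mp hf), fun _ => rfl⟩

/-- A generator of `starSphere` contains both ends of some edge `j` and no other cycle vertex, so it
lies in the join facet `j`. By cardinality it misses exactly one vertex of it, which must be a pole.
-/
theorem joinSphere_eq_starSphere (hn : n = d + (k + 3)) (E : Fin d ⊕ Fin (k + 3) ≃ Fin n)
    (hl : ∀ i, n - d ≤ (E (.inl i) : ℕ)) (hr : ∀ j, (E (.inr j) : ℕ) = j) :
    joinSphere E = starSphere n d := by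
  have hk : n - d = k + 3 := by omega
  have hsucc : ∀ j, (E (.inr (j + 1)) : ℕ) = ((E (.inr j) : ℕ) + 1) % (n - d) := fun j => by
    rw [hr, hr, hk, Fin.val_add]
    simp
  have hlt : ∀ j, (E (.inr j) : ℕ) < n - d := fun j => by
    rw [hr, hk]
    exact j.isLt
  unfold joinSphere starSphere
  congr 1
  ext s
  constructor
  · rintro ⟨⟨i, j⟩, rfl⟩
    refine ⟨card_joinSphereFacet E _, E (.inr j), E (.inr (j + 1)), hlt j, hsucc j, ?_⟩
    ext v
    obtain ⟨i' | l, rfl⟩ := E.surjective v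
    · simpa using fun _ => hl i'
    · simp [joinSphereFacet, hlt]
  · rintro ⟨hcard, a, b, ha, hb, hs⟩
    obtain ⟨j, rfl⟩ : ∃ j, E (.inr j) = a := ⟨⟨a, hk ▸ ha⟩, Fin.ext (hr _)⟩
    obtain rfl : E (.inr (j + 1)) = b := Fin.ext ((hsucc j).trans hb.symm)
    have hmem : ∀ l, E (.inr l) ∈ s ↔ l = j ∨ l = j + 1 := fun l => by
      have := Finset.ext_iff.mp hs (E (.inr l))
      simpa [hlt] using this
    have hsub : s ⊆ joinFacet E j := by
      intro v hv
      obtain ⟨i' | l, rfl⟩ := E.surjective v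
      · simp
      · exact (inr_mem_joinFacet E _ _).mpr ((hmem l).mp hv)
    obtain ⟨v, hv⟩ : ∃ v, joinFacet E j \ s = {v} := by
      rw [← card_eq_one, card_sdiff_of_subset hsub, card_joinFacet]
      omega
    have hsv : s = (joinFacet E j).erase v := by
      rw [← Finset.sdiff_sdiff_eq_self hsub, hv, sdiff_singleton_eq_erase]
    have hv' := mem_sdiff.mp (hv ▸ mem_singleton_self v)
    obtain ⟨i | l, rfl⟩ := E.surjective v
    · exact ⟨(i, j), hsv.symm⟩
    · exact absurd ((hmem l).mpr ((inr_mem_joinFacet E _ _).mp hv'.1)) hv'.2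

end Cycles

end LCSphere

theorem proposition5p1 (n d : ℕ) (hd : 1 ≤ d) (hn : d + 3 ≤ n) :
    (∀ C : SimpleGraph (LCSphere.NonPole n d), LCSphere.IsHamiltonCycle C →
      LCSphere.ballOf C = LCSphere.iteratedCone C ∧
      LCSphere.IsLCSphere d (LCSphere.sphereOf C) ∧
      LCSphere.facets (LCSphere.sphereOf C) =
        {s | ∃ x y : LCSphere.NonPole n d, C.Adj x y ∧
          ∃ v ∈ LCSphere.poles n d, s = (LCSphere.fSet x y).erase v} ∧
      (LCSphere.facets (LCSphere.sphereOf C)).ncard = d * (n - d)) ∧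
    LCSphere.IsHamiltonCycle (LCSphere.standardCycle n d) ∧
    (∃ e : Equiv.Perm (Fin n), (∀ i : Fin n, (e i : ℕ) = ((i : ℕ) + (n - d)) % n) ∧
      (LCSphere.sphereOf (LCSphere.standardCycle n d)).map e = LCSphere.starSphere n d) ∧
    LCSphere.IsLCSphere d (LCSphere.starSphere n d) := by
  obtain ⟨k, hk⟩ : ∃ k, n = d + (k + 3) := ⟨n - d - 3, by omega⟩
  have hstd := LCSphere.isCyclicOrder_standardOrder hk
  obtain ⟨e, he⟩ := LCSphere.exists_perm_add_sub_mod (show d ≤ n by omega)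
  -- After the relabelling the poles occupy the last `d` places and cycle vertex `j` is at place
  -- `j`.
  have hstar : LCSphere.joinSphere ((LCSphere.vertexEquiv hk (LCSphere.standardOrder hk)).trans e) =
      LCSphere.starSphere n d := by
    refine LCSphere.joinSphere_eq_starSphere hk _ (fun i => ?_) (fun j => ?_)
    · rw [Equiv.trans_apply, he, LCSphere.add_sub_mod_eq_ite (Fin.isLt _) (by omega)]
      simp
    · rw [Equiv.trans_apply, he, LCSphere.add_sub_mod_eq_ite (Fin.isLt _) (by omega)]
      simp
  refine ⟨fun C hC => ?_, hstd.isHamiltonCycle hk, ⟨e, he, ?_⟩, ?_⟩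
  · obtain ⟨k, hk, c, hc⟩ := hC.exists_isCyclicOrder
    refine ⟨hc.iteratedCone_eq, ?_, hc.facets_sphereOf hk, ?_⟩
    · rw [hc.sphereOf_eq hk]
      exact LCSphere.isLCSphere_joinSphere _ hd
    · rw [hc.sphereOf_eq hk, LCSphere.ncard_facets_joinSphere, show n - d = k + 3 by omega]
  · rw [hstd.sphereOf_eq hk, LCSphere.map_joinSphere, hstar]
  · rw [← hstar]
    exact LCSphere.isLCSphere_joinSphere _ hd
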